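/- Let $\partial=\partial_z$, $\bar\partial=\partial_{\bar z}$ on $\mathbb{R}^2\cong\mathbb{C}$, let $u:\mathbb{C}\to\mathbb{R}$ be a smooth solution of the sinh-Gordon equation $\partial\bar\partial u+\tfrac12\sinh(2u)=0$, and let $Q\neq0$ be a complex constant. For $\lambda\in\mathbb{C}^*$ put $$\alpha_\lambda=\tfrac12\begin{pmatrix}\partial u\,dz-\bar\partial u\,d\bar z& i\lambda^{-1}e^u\,dz+ie^{-u}\,d\bar z\\ ie^{-u}\,dz+i\lambda e^u\,d\bar z&-\partial u\,dz+\bar\partial u\,d\bar z\end{pmatrix}.$$ Assume that $u$ is of finite type, i.e. there is a polynomial Killing field $\xi$ for $u$: $\xi(\lambda,z)=\sum_{j=-1}^{g}c_j(z)\lambda^j$ with values in $\mathfrak{sl}(2,\mathbb{C})$ and smooth coefficients, $g\ge0$, such that $d\xi=[\xi,\alpha_\lambda]$, $\lambda^{g-1}\,\overline{\xi(1/\bar\lambda,z)}^{\,t}=-\xi(\lambda,z)$, and $c_{-1}(0)$ is a nonzero multiple of $\begin{pmatrix}0&1\\0&0\end{pmatrix}$. The spectral curve is $\nu^2=-\det\xi(\lambda,\cdot)$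 (which does not depend on $z$). Baker–Akhiezer functions at a point $(\lambda,\nu)$ of it are non-trivial solutions $\psi=(\psi_1,\psi_2)^t$, $\varphi=(\varphi_1,\varphi_2)^t$ of $d\psi=\alpha_\lambda^t\psi$, $d\varphi=-\alpha_\lambda\varphi$ with $\psi^t\xi=\nu\psi^t$ and $\xi\varphi=\nu\varphi$. Put $$y=\psi^t\varphi,\quad P=\frac{\psi\varphi^t}{\psi^t\varphi},\quad \omega=\psi_1\varphi_1-\psi_2\varphi_2,\quad \tau=\frac{i\psi_2\varphi_1}{e^uQ},\quad \sigma=-\frac{i\psi_1\varphi_2}{e^u\overline Q},\quad \phi=\partial\omega-2Q\tau .$$ Define $\omega_n,\tau_n,\sigma_n,\phi_n$ $(n\ge0)$ recursively by $\omega_0=0$, $\phi_0=-\tfrac12$, $\sigma_0=0$, $\tau_n=\partial\omega_n-\phi_n$, $\omega_{n+1}=\partial\tau_n+2\tau_n\,\partial u$, $\sigma_{n+1}=-e^{-2u}(\partial\omega_n+\phi_n)$ and $$\phi_{n+1}=\sum_{k=1}^{n}\bigl(\phi_k\phi_{n+1-k}-\partial\omega_k\,\partial\omega_{n+1-k}\bigr)+\sum_{k=1}^{n+1}\omega_k\,\omega_{n+2-k}.$$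 (a) These functions are smooth and satisfy all equations of the Pinkall–Sterling iteration: $\omega_1=\partial u$, $\phi_1=(\partial u)^2$, $\omega_2=\partial^3u-2(\partial u)^3$ and, for all $n\ge0$, $\bar\partial\partial\omega_n+\cosh(2u)\,\omega_n=0$; $\partial\tau_n=\partial^2\omega_n-2\partial\omega_n\partial u$, $\bar\partial\tau_n=-e^{-2u}\omega_n$; $\partial\phi_n=2\partial\omega_n\partial u$, $\bar\partial\phi_n=-\omega_n\sinh(2u)$; $\partial\sigma_n=-e^{-2u}\omega_n$, $\bar\partial\sigma_n=\bar\partial^2\omega_n-2\bar\partial\omega_n\bar\partial u$. (b) There are $r>0$ and a nowhere vanishing, odd, holomorphic function $\nu$ on $\{0<|\kappa|<r\}$ with $\nu(\kappa)^2=-\det\xi(\kappa^2,\cdot)$ (so $\kappa=\sqrt\lambda$ is a local parameter of the spectral curve at $\lambda=0$), such that for all $0<|\kappa|<r$, with $\lambda=\kappa^2$ and $\sqrt\lambda=\kappa$, all Baker–Akhiezer functions $\psi,\varphi$ at $(\lambda,\nu(\kappa))$ and all $z\in\mathbb{C}$, one has $y\ne0$ and the convergent expansions $$-\frac{i\omega}{2y}=\frac1{\sqrt\lambda}\sum_{n\ge1}\omega_n(-\lambda)^n,\qquad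 -\frac{iQ\tau}{y}=\frac{e^{-u}\psi_2\varphi_1}{y}=\frac1{\sqrt\lambda}\sum_{n\ge0}\tau_n(-\lambda)^n,$$ $$-\frac{i\overline Q\sigma}{y}=-\frac{e^{-u}\psi_1\varphi_2}{y}=\frac1{\sqrt\lambda}\sum_{n\ge1}\sigma_n(-\lambda)^n,$$ $$-\frac{i\phi}{2y}=\frac{iQ\tau-i\lambda^{-1}e^{2u}\overline Q\sigma}{2y}=\frac{-e^{-u}\psi_2\varphi_1-\lambda^{-1}e^u\psi_1\varphi_2}{2y}=\frac1{\sqrt\lambda}\sum_{n\ge0}\phi_n(-\lambda)^n .$$ Consequently the entries of $P$ have the expansions $$P_{11}-\tfrac12=-(P_{22}-\tfrac12)=\frac{i}{\sqrt\lambda}\sum_{n\ge1}\omega_n(-\lambda)^n,\quad P_{21}=\frac{e^u}{\sqrt\lambda}\sum_{n\ge0}\tau_n(-\lambda)^n,\quad P_{12}=-\frac{e^u}{\sqrt\lambda}\sum_{n\ge1}\sigma_n(-\lambda)^n .$$ (c) If moreover $u(z+\gamma)=u(z)$ for all $z$, then for $0<|\lambda|<r^2$, every $\mu\ne\pm1$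 and all non-trivial solutions $\psi,\varphi$ of $d\psi=\alpha_\lambda^t\psi$, $d\varphi=-\alpha_\lambda\varphi$ with $\psi(z+\gamma)=\mu\psi(z)$, $\varphi(z+\gamma)=\mu^{-1}\varphi(z)$ for all $z$, there is a square root $\kappa$ of $\lambda$ such that $\psi,\varphi$ are Baker–Akhiezer functions at $(\lambda,\nu(\kappa))$, and hence all expansions of (b) hold with $\sqrt\lambda=\kappa$ for all $z$. -/

import Mathlib

open Complex
open scoped ContDiff ComplexConjugate Matrix

noncomputable section

/-- The Wirtinger derivative `∂f = ½ (∂ₓf - i ∂_yf)`; functions on the plane are functions on `ℂ`,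
differentiated as maps of real vector spaces. -/
def dz (f : ℂ → ℂ) (z : ℂ) : ℂ := (1 / 2) * (fderiv ℝ f z 1 - I * fderiv ℝ f z I)

/-- The Wirtinger derivative `∂̄f = ½ (∂ₓf + i ∂_yf)`. -/
def dzbar (f : ℂ → ℂ) (z : ℂ) : ℂ := (1 / 2) * (fderiv ℝ f z 1 + I * fderiv ℝ f z I)

/-- A real function on the plane, regarded as a complex-valued function. -/
def toC (u : ℂ → ℝ) (z : ℂ) : ℂ := (u z : ℂ)

/-- `u` is a smooth real solution of the sinh-Gordon equation `∂∂̄u + ½ sinh(2u) = 0`. -/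
structure IsSinhGordon (u : ℂ → ℝ) : Prop where
  smooth : ContDiff ℝ ∞ u
  eqn : ∀ z, dz (dzbar (toC u)) z + (1 / 2) * Complex.sinh (2 * toC u z) = 0

/-! ### The connection form and its solutions -/

/-- The `dz`-part of the connection form `α_l`. -/
def alphaDz (u : ℂ → ℝ) (l z : ℂ) : Matrix (Fin 2) (Fin 2) ℂ :=
  (1 / 2 : ℂ) • !![dz (toC u) z, I * l⁻¹ * exp (toC u z);
                   I * exp (-toC u z), -dz (toC u) z]

/-- The `dz̄`-part of the connection form `α_l`. -/
def alphaDzbar (u : ℂ → ℝ) (l z : ℂ) : Matrix (Fin 2) (Fin 2) ℂ :=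
  (1 / 2 : ℂ) • !![-dzbar (toC u) z, I * exp (-toC u z);
                   I * l * exp (toC u z), dzbar (toC u) z]

/-- `ψ = (ψ₁, ψ₂)ᵗ` solves `dψ = α_lᵗ ψ`, i.e.
`∂ψ = ½ (∂u, i e^{-u}; i l⁻¹ e^u, -∂u) ψ`, `∂̄ψ = ½ (-∂̄u, i l e^u; i e^{-u}, ∂̄u) ψ`. -/
structure SolvesPsi (u : ℂ → ℝ) (l : ℂ) (ψ : ℂ → Fin 2 → ℂ) : Prop where
  diff : ∀ i, Differentiable ℝ fun z => ψ z i
  dz_eq : ∀ z i, dz (fun w => ψ w i) z = ((alphaDz u l z)ᵀ *ᵥ ψ z) i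
  dzbar_eq : ∀ z i, dzbar (fun w => ψ w i) z = ((alphaDzbar u l z)ᵀ *ᵥ ψ z) i

/-- `φ = (φ₁, φ₂)ᵗ` solves `dφ = -α_l φ`, i.e.
`∂φ = -½ (∂u, i l⁻¹ e^u; i e^{-u}, -∂u) φ`, `∂̄φ = -½ (-∂̄u, i e^{-u}; i l e^u, ∂̄u) φ`. -/
structure SolvesPhi (u : ℂ → ℝ) (l : ℂ) (φ : ℂ → Fin 2 → ℂ) : Prop where
  diff : ∀ i, Differentiable ℝ fun z => φ z i
  dz_eq : ∀ z i, dz (fun w => φ w i) z = -((alphaDz u l z) *ᵥ φ z) i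
  dzbar_eq : ∀ z i, dzbar (fun w => φ w i) z = -((alphaDzbar u l z) *ᵥ φ z) i

/-! ### Finite type: polynomial Killing fields and Baker-Akhiezer functions -/

/-- `ξ = ξ(l, z)` is a polynomial Killing field for `u`: for each `z` a Laurent polynomial
`∑_{j=-1}^g c_j(z) l^j` with values in `sl(2, ℂ)`, satisfying the reality condition
`l^{g-1} (conj ξ(1/conj l))ᵗ = -ξ(l)`, whose lowest coefficient at `z = 0` is a nonzero multiple of
`(0 1; 0 0)`, and which solves `dξ = [ξ, α]`. -/
structure IsPolynomialKillingField (u : ℂ → ℝ) (g : ℕ)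
    (ξ : ℂ → ℂ → Matrix (Fin 2) (Fin 2) ℂ) : Prop where
  laurent : ∃ c : ℕ → ℂ → Matrix (Fin 2) (Fin 2) ℂ,
    (∀ j a b, ContDiff ℝ ∞ fun z => c j z a b) ∧
    (∃ k : ℂ, k ≠ 0 ∧ c 0 0 = k • !![0, 1; 0, 0]) ∧
    ∀ l, l ≠ 0 → ∀ z, ξ l z = ∑ j ∈ Finset.range (g + 2), l ^ ((j : ℤ) - 1) • c j z
  trace_eq : ∀ l, l ≠ 0 → ∀ z, (ξ l z).trace = 0
  reality : ∀ l, l ≠ 0 → ∀ z, l ^ ((g : ℤ) - 1) • (ξ (conj l)⁻¹ z)ᴴ = -ξ l z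
  dz_eq : ∀ l, l ≠ 0 → ∀ z a b, dz (fun w => ξ l w a b) z
    = (ξ l z * alphaDz u l z - alphaDz u l z * ξ l z) a b
  dzbar_eq : ∀ l, l ≠ 0 → ∀ z a b, dzbar (fun w => ξ l w a b) z
    = (ξ l z * alphaDzbar u l z - alphaDzbar u l z * ξ l z) a b

/-- A pair of (not necessarily normalized) Baker-Akhiezer functions at the point `(l, ν)` of the
spectral curve `ν² = -det ξ`: non-trivial solutions `ψ`, `φ` of the linear systems such that `ψᵗ` is
a transposed eigenvector and `φ` an eigenvector of `ξ` with eigenvalue `ν`. -/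
structure IsBakerAkhiezerPair (u : ℂ → ℝ) (ξ : ℂ → ℂ → Matrix (Fin 2) (Fin 2) ℂ) (l ν : ℂ)
    (ψ φ : ℂ → Fin 2 → ℂ) : Prop where
  psi : SolvesPsi u l ψ
  phi : SolvesPhi u l φ
  psi_ne : ψ ≠ 0
  phi_ne : φ ≠ 0
  psi_eig : ∀ z, ψ z ᵥ* ξ l z = ν • ψ z
  phi_eig : ∀ z, ξ l z *ᵥ φ z = ν • φ z

/-- Non-trivial solutions `ψ`, `φ` of the linear systems that are eigenfunctions of the translation
by `γ`, with inverse eigenvalues `μ` and `μ⁻¹`. -/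
structure IsMonodromyPair (u : ℂ → ℝ) (γ l μ : ℂ) (ψ φ : ℂ → Fin 2 → ℂ) : Prop where
  psi : SolvesPsi u l ψ
  phi : SolvesPhi u l φ
  psi_ne : ψ ≠ 0
  phi_ne : φ ≠ 0
  psi_mult : ∀ z, ψ (z + γ) = μ • ψ z
  phi_mult : ∀ z, φ (z + γ) = μ⁻¹ • φ z

/-! ### The functions built from `ψ` and `φ` -/

/-- `y = ψᵗ φ`. -/
def yFun (ψ φ : ℂ → Fin 2 → ℂ) (z : ℂ) : ℂ := ψ z ⬝ᵥ φ z

/-- `P = ψ φᵗ / (ψᵗ φ)`. -/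
def PMat (ψ φ : ℂ → Fin 2 → ℂ) (z : ℂ) : Matrix (Fin 2) (Fin 2) ℂ :=
  (yFun ψ φ z)⁻¹ • Matrix.vecMulVec (ψ z) (φ z)

/-- `ω = ψ₁φ₁ - ψ₂φ₂`. -/
def omegaFun (ψ φ : ℂ → Fin 2 → ℂ) (z : ℂ) : ℂ := ψ z 0 * φ z 0 - ψ z 1 * φ z 1

/-- `τ = i ψ₂φ₁ / (e^u Q)`. -/
def tauFun (u : ℂ → ℝ) (Q : ℂ) (ψ φ : ℂ → Fin 2 → ℂ) (z : ℂ) : ℂ :=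
  I * ψ z 1 * φ z 0 / (exp (toC u z) * Q)

/-- `σ = -i ψ₁φ₂ / (e^u Q̄)`. -/
def sigmaFun (u : ℂ → ℝ) (Q : ℂ) (ψ φ : ℂ → Fin 2 → ℂ) (z : ℂ) : ℂ :=
  -(I * ψ z 0 * φ z 1) / (exp (toC u z) * conj Q)

/-- `ϕ = ∂ω - 2Qτ`. -/
def phiFun (u : ℂ → ℝ) (Q : ℂ) (ψ φ : ℂ → Fin 2 → ℂ) (z : ℂ) : ℂ :=
  dz (omegaFun ψ φ) z - 2 * Q * tauFun u Q ψ φ z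

/-! ### The Pinkall-Sterling iteration -/

/-- The pairs `(ω_n, ϕ_n)`: `ω_0 = 0`, `ϕ_0 = -½`, `ω_{n+1} = ∂τ_n + 2 τ_n ∂u` with
`τ_n = ∂ω_n - ϕ_n`, and `ϕ_{n+1}`, free of integration constants, equal to
`∑_{k=1}^n (ϕ_k ϕ_{n+1-k} - ∂ω_k ∂ω_{n+1-k}) + ∑_{k=1}^{n+1} ω_k ω_{n+2-k}`.
The unfolded recursion is stated in `psOmega_succ` and `psPhi_succ`. -/
def psPair (u : ℂ → ℝ) : ℕ → (ℂ → ℂ) × (ℂ → ℂ)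
  | 0 => (fun _ => 0, fun _ => -1 / 2)
  | n + 1 =>
    let t : ℂ → ℂ := fun z => dz (psPair u n).1 z - (psPair u n).2 z
    let w' : ℂ → ℂ := fun z => dz t z + 2 * t z * dz (toC u) z
    let w : ℕ → ℂ → ℂ := fun k => if _h : k < n + 1 then (psPair u k).1 else w'
    let p : ℕ → ℂ → ℂ := fun k => if _h : k < n + 1 then (psPair u k).2 else fun _ => 0
    (w', fun z =>
      ∑ k ∈ Finset.Icc 1 n, (p k z * p (n + 1 - k) z - dz (w k) z * dz (w (n + 1 - k)) z)
        + ∑ k ∈ Finset.Icc 1 (n + 1), w k z * w (n + 2 - k) z)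

def psOmega (u : ℂ → ℝ) (n : ℕ) : ℂ → ℂ := (psPair u n).1

def psPhi (u : ℂ → ℝ) (n : ℕ) : ℂ → ℂ := (psPair u n).2

/-- `τ_n = ∂ω_n - ϕ_n`. -/
def psTau (u : ℂ → ℝ) (n : ℕ) : ℂ → ℂ := fun z => dz (psOmega u n) z - psPhi u n z

/-- `σ_n = -e^{-2u} (∂ω_{n-1} + ϕ_{n-1})` for `n ≥ 1`, and `σ_0 = 0`. -/
def psSigma (u : ℂ → ℝ) : ℕ → ℂ → ℂ
  | 0 => fun _ => 0
  | n + 1 => fun z => -exp (-2 * toC u z) * (dz (psOmega u n) z + psPhi u n z)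

theorem psOmega_zero (u : ℂ → ℝ) : psOmega u 0 = fun _ => 0 := by
  simp [psOmega, psPair]

theorem psPhi_zero (u : ℂ → ℝ) : psPhi u 0 = fun _ => -1 / 2 := by
  simp [psPhi, psPair]

theorem psOmega_succ (u : ℂ → ℝ) (n : ℕ) :
    psOmega u (n + 1) = fun z => dz (psTau u n) z + 2 * psTau u n z * dz (toC u) z := by
  rw [psOmega, psPair]
  rfl

theorem psPhi_succ (u : ℂ → ℝ) (n : ℕ) :
    psPhi u (n + 1) = fun z =>
      ∑ k ∈ Finset.Icc 1 n, (psPhi u k z * psPhi u (n + 1 - k) z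
          - dz (psOmega u k) z * dz (psOmega u (n + 1 - k)) z)
        + ∑ k ∈ Finset.Icc 1 (n + 1), psOmega u k z * psOmega u (n + 2 - k) z := by
  have hw : ∀ k, k ≤ n + 1 → (if _h : k < n + 1 then (psPair u k).1 else
      fun z => dz (fun z => dz (psPair u n).1 z - (psPair u n).2 z) z
        + 2 * (dz (psPair u n).1 z - (psPair u n).2 z) * dz (toC u) z) = psOmega u k := by
    intro k hk
    split_ifs with h
    · rfl
    · obtain rfl : k = n + 1 := by omega
      rw [psOmega_succ]
      rfl
  funext z
  rw [psPhi, psPair]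
  dsimp only
  congr 1
  · refine Finset.sum_congr rfl fun k hk => ?_
    rw [Finset.mem_Icc] at hk
    rw [hw k (by omega), hw (n + 1 - k) (by omega), dif_pos (by omega : k < n + 1),
      dif_pos (by omega : n + 1 - k < n + 1)]
    rfl
  · refine Finset.sum_congr rfl fun k hk => ?_
    rw [Finset.mem_Icc] at hk
    rw [hw k (by omega), hw (n + 2 - k) (by omega)]

/-- Sequences `w = (ω_n)`, `t = (τ_n)`, `s = (σ_n)`, `p = (ϕ_n)` of smooth functions
satisfying all the equations of the Pinkall-Sterling iteration: each `ω_n` solves the homogeneous Jacobi equation, `τ_n` and `σ_n` supplement it to a parametric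
Jacobi field, `ϕ_n = ∂ω_n - τ_n`, and `ω_{n+1} = ∂τ_n + 2 τ_n ∂u`. -/
structure IsPinkallSterlingIteration (u : ℂ → ℝ) (w t s p : ℕ → ℂ → ℂ) : Prop where
  smooth : ∀ n, ContDiff ℝ ∞ (w n) ∧ ContDiff ℝ ∞ (t n) ∧ ContDiff ℝ ∞ (s n) ∧ ContDiff ℝ ∞ (p n)
  omega_one : ∀ z, w 1 z = dz (toC u) z
  phi_one : ∀ z, p 1 z = dz (toC u) z ^ 2
  omega_two : ∀ z, w 2 z = dz (dz (dz (toC u))) z - 2 * dz (toC u) z ^ 3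
  jacobi : ∀ n z, dzbar (dz (w n)) z + Complex.cosh (2 * toC u z) * w n z = 0
  omega_succ : ∀ n z, w (n + 1) z = dz (t n) z + 2 * t n z * dz (toC u) z
  tau_eq : ∀ n z, t n z = dz (w n) z - p n z
  dz_tau : ∀ n z, dz (t n) z = dz (dz (w n)) z - 2 * dz (w n) z * dz (toC u) z
  dzbar_tau : ∀ n z, dzbar (t n) z = -exp (-2 * toC u z) * w n z
  dz_phi : ∀ n z, dz (p n) z = 2 * dz (w n) z * dz (toC u) z
  dzbar_phi : ∀ n z, dzbar (p n) z = -w n z * Complex.sinh (2 * toC u z)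
  sigma_succ : ∀ n z, s (n + 1) z = -exp (-2 * toC u z) * (dz (w n) z + p n z)
  dz_sigma : ∀ n z, dz (s n) z = -exp (-2 * toC u z) * w n z
  dzbar_sigma : ∀ n z, dzbar (s n) z
    = dzbar (dzbar (w n)) z - 2 * dzbar (w n) z * dzbar (toC u) z

/-! ### The series -/

/-- `v = l^{-1/2} ∑_{n ≥ 0} a_n (-l)^n` with convergent series, where `l = κ²`, `l^{1/2} = κ`. -/
def HasHalfSeries (κ : ℂ) (a : ℕ → ℂ) (v : ℂ) : Prop :=
  HasSum (fun n => κ⁻¹ * (a n * (-κ ^ 2) ^ n)) v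

/-- The expansions at the point `z`, for `l = κ²` and the root `l^{1/2} = κ`.
Recall that `ω_0 = σ_0 = 0`. -/
structure SeriesExpansion (u : ℂ → ℝ) (Q κ : ℂ) (ψ φ : ℂ → Fin 2 → ℂ) (z : ℂ) : Prop where
  y_ne : yFun ψ φ z ≠ 0
  omega_series :
    HasHalfSeries κ (fun n => psOmega u n z) (-(I * omegaFun ψ φ z) / (2 * yFun ψ φ z))
  tau_eq : -(I * Q * tauFun u Q ψ φ z) / yFun ψ φ z
    = exp (-toC u z) * ψ z 1 * φ z 0 / yFun ψ φ z
  tau_series :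
    HasHalfSeries κ (fun n => psTau u n z) (-(I * Q * tauFun u Q ψ φ z) / yFun ψ φ z)
  sigma_eq : -(I * conj Q * sigmaFun u Q ψ φ z) / yFun ψ φ z
    = -exp (-toC u z) * ψ z 0 * φ z 1 / yFun ψ φ z
  sigma_series :
    HasHalfSeries κ (fun n => psSigma u n z) (-(I * conj Q * sigmaFun u Q ψ φ z) / yFun ψ φ z)
  phi_eq : -(I * phiFun u Q ψ φ z) / (2 * yFun ψ φ z)
    = (I * Q * tauFun u Q ψ φ z
        - I * (κ ^ 2)⁻¹ * exp (2 * toC u z) * conj Q * sigmaFun u Q ψ φ z) / (2 * yFun ψ φ z)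
  phi_eq' : -(I * phiFun u Q ψ φ z) / (2 * yFun ψ φ z)
    = (-exp (-toC u z) * ψ z 1 * φ z 0
        - (κ ^ 2)⁻¹ * exp (toC u z) * ψ z 0 * φ z 1) / (2 * yFun ψ φ z)
  phi_series :
    HasHalfSeries κ (fun n => psPhi u n z) (-(I * phiFun u Q ψ φ z) / (2 * yFun ψ φ z))
  P_11 : HasHalfSeries κ (fun n => I * psOmega u n z) (PMat ψ φ z 0 0 - 1 / 2)
  P_22 : HasHalfSeries κ (fun n => -I * psOmega u n z) (PMat ψ φ z 1 1 - 1 / 2)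
  P_12 : HasHalfSeries κ (fun n => -exp (toC u z) * psSigma u n z) (PMat ψ φ z 0 1)
  P_21 : HasHalfSeries κ (fun n => exp (toC u z) * psTau u n z) (PMat ψ φ z 1 0)

end

/-! Everything comes from one formal object: a power series `A` in `x = -l`, with entries `a_n, b_n,
c_n`, solving `dA = [A, α_l]` with `-det A = l/4` and upper right entry `½ e^u + O(l)` at the
origin. Multiplying a solution by a function of `l` alone gives another solution, and `det ξ` does
not depend on `z`. So `A = l ξ / (2 s)` works, where `s² = x det ξ(-x)`. The right side extends
holomorphically to `x = 0` with value `k² e^{-2u(0)} ≠ 0`, where `k` comes from `c_{-1}(0)`, so a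
holomorphic `s` exists near `0` (`exists_normalization`).

Put `ω_n = -i a_n`, `τ_n = e^{-u} b_n`, `σ_n = -e^{-u} c_n` and `ϕ_n = -½ (e^{-u} b_n - e^u
c_{n+1})`. The differential equations of the iteration are then the entries of `dA = [A, α]`, and
the quadratic recursion for `ϕ_{n+1}` is the coefficient of order `n + 2` in the determinant
condition (`phiCoeff_succ`). As the recursion contains no integration constant, these functions are
the ones defined from `u` alone (`psOmega_psPhi_eq`), which proves (a).

For (b), the transpose of `P` is the spectral projector `½ (1 + ξ/ν)`. With `ν = s(-κ²)/κ` one has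
`ξ/(2ν) = κ⁻¹ A`, so the expansions of `P` are those of `A`.

For (c), `A` is determined by `u`, hence inherits its periods, and so does `ξ` for small `l`. A
Wronskian argument then shows that eigenfunctions of the monodromy with `μ² ≠ 1` are eigenvectors of
`ξ`; the sign of the eigenvalue is absorbed in the choice of `κ` because `ν` is odd. -/

noncomputable section

/-! ### Wirtinger calculus -/

/-- The derivation `½ (∂ₓ + e ∂_y)`, which is `∂` for `e = -i` and `∂̄` for `e = i`. -/
def wirt (e : ℂ) (f : ℂ → ℂ) (z : ℂ) : ℂ := (1 / 2) * (fderiv ℝ f z 1 + e * fderiv ℝ f z I)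

theorem dz_eq_wirt : dz = wirt (-I) := by
  funext f z; simp only [dz, wirt]; ring

theorem dzbar_eq_wirt : dzbar = wirt I := rfl

theorem wirt_const (e c : ℂ) (z : ℂ) : wirt e (fun _ => c) z = 0 := by
  simp [wirt]

theorem wirt_add (e : ℂ) {f g : ℂ → ℂ} {z : ℂ} (hf : DifferentiableAt ℝ f z)
    (hg : DifferentiableAt ℝ g z) : wirt e (fun w => f w + g w) z = wirt e f z + wirt e g z := by
  simp only [wirt, fderiv_fun_add hf hg, add_apply]; ring

theorem wirt_sub (e : ℂ) {f g : ℂ → ℂ} {z : ℂ} (hf : DifferentiableAt ℝ f z)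
    (hg : DifferentiableAt ℝ g z) : wirt e (fun w => f w - g w) z = wirt e f z - wirt e g z := by
  simp only [wirt, fderiv_fun_sub hf hg, sub_apply]; ring

theorem wirt_neg (e : ℂ) (f : ℂ → ℂ) (z : ℂ) : wirt e (fun w => -f w) z = -wirt e f z := by
  simp only [wirt, fderiv_fun_neg, neg_apply]; ring

theorem wirt_mul (e : ℂ) {f g : ℂ → ℂ} {z : ℂ} (hf : DifferentiableAt ℝ f z)
    (hg : DifferentiableAt ℝ g z) :
    wirt e (fun w => f w * g w) z = wirt e f z * g z + f z * wirt e g z := by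
  simp only [wirt, fderiv_fun_mul hf hg, add_apply,
    smul_apply, smul_eq_mul]; ring

theorem wirt_const_mul (e c : ℂ) {f : ℂ → ℂ} {z : ℂ} (hf : DifferentiableAt ℝ f z) :
    wirt e (fun w => c * f w) z = c * wirt e f z := by
  rw [wirt_mul e (differentiableAt_const c) hf, wirt_const]; ring

theorem wirt_sum (e : ℂ) {ι : Type*} (s : Finset ι) {f : ι → ℂ → ℂ} {z : ℂ}
    (hf : ∀ i, DifferentiableAt ℝ (f i) z) :
    wirt e (fun w => ∑ i ∈ s, f i w) z = ∑ i ∈ s, wirt e (f i) z := by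
  classical
  induction s using Finset.induction_on with
  | empty => simp [wirt]
  | insert i s hi ih =>
    simp only [Finset.sum_insert hi]
    rw [wirt_add e (hf i) (DifferentiableAt.fun_sum fun i _ => hf i), ih]

theorem wirt_exp (e : ℂ) {f : ℂ → ℂ} {z : ℂ} (hf : DifferentiableAt ℝ f z) :
    wirt e (fun w => exp (f w)) z = exp (f z) * wirt e f z := by
  have h : HasFDerivAt (fun w => exp (f w)) (exp (f z) • fderiv ℝ f z) z := hf.hasFDerivAt.cexp
  simp only [wirt, h.fderiv, smul_apply, smul_eq_mul]; ring

theorem contDiff_wirt (e : ℂ) {f : ℂ → ℂ} (hf : ContDiff ℝ ∞ f) : ContDiff ℝ ∞ (wirt e f) := by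
  have h : ContDiff ℝ ∞ (fderiv ℝ f) := hf.fderiv_right (by simp)
  unfold wirt
  fun_prop

theorem wirt_comp_add_right (e : ℂ) (f : ℂ → ℂ) (c z : ℂ) :
    wirt e (fun w => f (w + c)) z = wirt e f (z + c) := by
  simp only [wirt, fderiv_comp_add_right]

theorem wirt_periodic (e : ℂ) {f : ℂ → ℂ} {c : ℂ} (hf : ∀ z, f (z + c) = f z) (z : ℂ) :
    wirt e f (z + c) = wirt e f z := by
  rw [← wirt_comp_add_right, funext hf]

theorem fderiv_eq_dz_dzbar (f : ℂ → ℂ) (z v : ℂ) :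
    fderiv ℝ f z v = dz f z * v + dzbar f z * conj v := by
  have hv : v = v.re • (1 : ℂ) + v.im • I := by simp
  have h : fderiv ℝ f z v = v.re * fderiv ℝ f z 1 + v.im * fderiv ℝ f z I := by
    conv_lhs => rw [hv, map_add, map_smul, map_smul]
    simp
  have hc : conj v = v.re - v.im * I := by apply Complex.ext <;> simp
  have hv' : v = v.re + v.im * I := by simp
  rw [h, hc]
  conv_rhs => rw [hv']
  simp only [dz, dzbar, add_re, ofReal_re, mul_re, I_re, mul_zero, ofReal_im, I_im, mul_one,
    sub_self, add_zero, add_im, mul_im, zero_add]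
  linear_combination ((v.im : ℂ) * fderiv ℝ f z I) * I_sq

theorem eq_of_dz_dzbar_eq_zero {f : ℂ → ℂ} (hf : Differentiable ℝ f) (h1 : ∀ z, dz f z = 0)
    (h2 : ∀ z, dzbar f z = 0) (z w : ℂ) : f z = f w := by
  refine is_const_of_fderiv_eq_zero (𝕜 := ℝ) hf (fun z => ?_) z w
  ext v
  simp [fderiv_eq_dz_dzbar, h1, h2]

/-! ### The linear systems -/

/-- Gronwall's inequality with zero initial value; the sum of the norms of all entries bounds the
operator norm for the sup norm. -/
theorem linear_ode_eq_zero {f : ℝ → Fin 2 → ℂ} {B : ℝ → Matrix (Fin 2) (Fin 2) ℂ}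
    (hB : ∀ i j, Continuous fun t => B t i j) (hf : ∀ t, HasDerivAt f (B t *ᵥ f t) t)
    (h0 : f 0 = 0) : f 1 = 0 := by
  have hc : Continuous fun t => ∑ i, ∑ j, ‖B t i j‖ := by fun_prop
  obtain ⟨K, hK⟩ := (isCompact_Icc (a := (0 : ℝ)) (b := 1)).exists_bound_of_continuousOn
    hc.continuousOn
  have hbound : ∀ t ∈ Set.Ico (0 : ℝ) 1, ‖B t *ᵥ f t‖ ≤ K * ‖f t‖ + 0 := by
    intro t ht
    have hKt := (le_abs_self _).trans (hK t (Set.Ico_subset_Icc_self ht))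
    rw [add_zero]
    refine (pi_norm_le_iff_of_nonneg (mul_nonneg ?_ (norm_nonneg _))).2 fun i => ?_
    · exact le_trans (by positivity) hKt
    calc ‖(B t *ᵥ f t) i‖ = ‖∑ j, B t i j * f t j‖ := rfl
      _ ≤ ∑ j, ‖B t i j‖ * ‖f t‖ := by
        refine (norm_sum_le _ _).trans (Finset.sum_le_sum fun j _ => ?_)
        rw [norm_mul]
        exact mul_le_mul_of_nonneg_left (norm_le_pi_norm _ _) (norm_nonneg _)
      _ = (∑ j, ‖B t i j‖) * ‖f t‖ := by rw [Finset.sum_mul]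
      _ ≤ K * ‖f t‖ := by
        refine mul_le_mul_of_nonneg_right (le_trans ?_ hKt) (norm_nonneg _)
        exact Finset.single_le_sum (f := fun i => ∑ j, ‖B t i j‖)
          (fun _ _ => by positivity) (Finset.mem_univ i)
  have := norm_le_gronwallBound_of_norm_deriv_right_le (δ := 0) (a := 0) (b := 1)
    (fun t _ => (hf t).continuousAt.continuousWithinAt)
    (fun t _ => (hf t).hasDerivWithinAt) (by simp [h0]) hbound 1 (by simp)
  simpa [gronwallBound_ε0_δ0] using this

theorem contDiff_toC {u : ℂ → ℝ} (hu : ContDiff ℝ ∞ u) : ContDiff ℝ ∞ (toC u) :=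
  ofRealCLM.contDiff.comp hu

namespace SolvesPsi

variable {u : ℂ → ℝ} {l : ℂ} {ψ χ : ℂ → Fin 2 → ℂ}

theorem eq_zero (hu : ContDiff ℝ ∞ u) (h : SolvesPsi u l ψ) {z₀ : ℂ} (h0 : ψ z₀ = 0) : ψ = 0 := by
  funext z
  have hU : Continuous (toC u) := (contDiff_toC hu).continuous
  have hU1 : Continuous (dz (toC u)) := by
    rw [dz_eq_wirt]; exact (contDiff_wirt _ (contDiff_toC hu)).continuous
  have hU2 : Continuous (dzbar (toC u)) := (contDiff_wirt _ (contDiff_toC hu)).continuous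
  set v := z - z₀ with hv
  -- Along the segment from `z₀` to `z` the two Wirtinger equations combine into a single linear
  -- ODE.
  let p : ℝ → ℂ := fun t => z₀ + t * v
  have hp : Continuous p := by fun_prop
  have hp' : ∀ t, HasDerivAt p v t := fun t => by
    simpa [p] using ((Complex.ofRealCLM.hasDerivAt (x := t)).mul_const v).const_add z₀
  have := linear_ode_eq_zero (f := fun t => ψ (p t))
    (B := fun t => (v • (alphaDz u l (p t))ᵀ + conj v • (alphaDzbar u l (p t))ᵀ)) ?_ ?_ ?_
  · simpa [p, hv] using this
  · have e1 : Continuous fun t => toC u (p t) := hU.comp hp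
    have e2 : Continuous fun t => dz (toC u) (p t) := hU1.comp hp
    have e3 : Continuous fun t => dzbar (toC u) (p t) := hU2.comp hp
    intro i j
    fin_cases i <;> fin_cases j <;> simp [alphaDz, alphaDzbar] <;> fun_prop
  · intro t
    rw [hasDerivAt_pi]
    intro i
    have := ((h.diff i) (p t)).hasFDerivAt.comp_hasDerivAt t (hp' t)
    rw [fderiv_eq_dz_dzbar, h.dz_eq, h.dzbar_eq] at this
    convert this using 1
    · rfl
    · rw [Matrix.add_mulVec, Matrix.smul_mulVec, Matrix.smul_mulVec]
      simp only [Pi.add_apply, Pi.smul_apply, smul_eq_mul]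
      ring
  · change ψ (z₀ + ((0 : ℝ) : ℂ) * v) = 0
    rw [ofReal_zero, zero_mul, add_zero, h0]

theorem ne_zero (hu : ContDiff ℝ ∞ u) (h : SolvesPsi u l ψ) (hne : ψ ≠ 0) (z : ℂ) : ψ z ≠ 0 :=
  fun h0 => hne (h.eq_zero hu h0)

theorem sub_smul (h : SolvesPsi u l ψ) (h' : SolvesPsi u l χ) (c : ℂ) :
    SolvesPsi u l (fun z => χ z - c • ψ z) := by
  have key : ∀ e i z, wirt e (fun w => (χ w - c • ψ w) i) z
      = wirt e (fun w => χ w i) z - c * wirt e (fun w => ψ w i) z := fun e i z => by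
    rw [← wirt_const_mul e c (h.diff i z), ← wirt_sub e (h'.diff i z) ((h.diff i z).const_mul c)]
    rfl
  refine ⟨fun i => (h'.diff i).sub ((h.diff i).const_mul c), fun z i => ?_, fun z i => ?_⟩
  · rw [dz_eq_wirt, key, ← dz_eq_wirt, h.dz_eq, h'.dz_eq, Matrix.mulVec_sub, Matrix.mulVec_smul]
    rfl
  · rw [dzbar_eq_wirt, key, ← dzbar_eq_wirt, h.dzbar_eq, h'.dzbar_eq, Matrix.mulVec_sub, Matrix.mulVec_smul]
    rfl

/-- The Wronskian of two solutions is constant. -/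
theorem wronskian_const (h : SolvesPsi u l ψ) (h' : SolvesPsi u l χ) (z w : ℂ) :
    ψ z 0 * χ z 1 - ψ z 1 * χ z 0 = ψ w 0 * χ w 1 - ψ w 1 * χ w 0 := by
  have key : ∀ e z, wirt e (fun z => ψ z 0 * χ z 1 - ψ z 1 * χ z 0) z
      = wirt e (fun w => ψ w 0) z * χ z 1 + ψ z 0 * wirt e (fun w => χ w 1) z
        - (wirt e (fun w => ψ w 1) z * χ z 0 + ψ z 1 * wirt e (fun w => χ w 0) z) := fun e z => by
    rw [wirt_sub e ((h.diff 0 z).fun_mul (h'.diff 1 z)) ((h.diff 1 z).fun_mul (h'.diff 0 z)),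
      wirt_mul e (h.diff 0 z) (h'.diff 1 z), wirt_mul e (h.diff 1 z) (h'.diff 0 z)]
  refine eq_of_dz_dzbar_eq_zero (f := fun z => ψ z 0 * χ z 1 - ψ z 1 * χ z 0)
    (((h.diff 0).mul (h'.diff 1)).sub ((h.diff 1).mul (h'.diff 0))) (fun z => ?_) (fun z => ?_) z w
  · rw [dz_eq_wirt, key, ← dz_eq_wirt, h.dz_eq, h'.dz_eq, h.dz_eq, h'.dz_eq]
    simp [alphaDz, Matrix.mulVec, dotProduct, Fin.sum_univ_two]
    ring
  · rw [dzbar_eq_wirt, key, ← dzbar_eq_wirt, h.dzbar_eq, h'.dzbar_eq, h.dzbar_eq, h'.dzbar_eq]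
    simp [alphaDzbar, Matrix.mulVec, dotProduct, Fin.sum_univ_two]
    ring

/-- Solutions which are linearly dependent at one point are proportional. -/
theorem eq_smul_of_wronskian (hu : ContDiff ℝ ∞ u) (h : SolvesPsi u l ψ) (hne : ψ ≠ 0)
    (h' : SolvesPsi u l χ) {z₀ : ℂ} (hW : ψ z₀ 0 * χ z₀ 1 - ψ z₀ 1 * χ z₀ 0 = 0) :
    ∃ c : ℂ, ∀ z, χ z = c • ψ z := by
  have h0 := h.ne_zero hu hne z₀
  obtain ⟨c, hc⟩ : ∃ c : ℂ, χ z₀ = c • ψ z₀ := by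
    by_cases h1 : ψ z₀ 0 = 0
    · have h2 : ψ z₀ 1 ≠ 0 := fun h2 => h0 (by ext i; fin_cases i <;> simp [h1, h2])
      refine ⟨χ z₀ 1 / ψ z₀ 1, ?_⟩
      have h3 : χ z₀ 0 = 0 := by simpa [h1, h2] using hW
      ext i; fin_cases i <;> simp [h1, h2, h3]
    · refine ⟨χ z₀ 0 / ψ z₀ 0, ?_⟩
      ext i; fin_cases i
      · simp [h1]
      · simp only [Fin.mk_one, Pi.smul_apply, smul_eq_mul]
        field_simp
        linear_combination hW
  refine ⟨c, fun z => ?_⟩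
  have := (h.sub_smul h' c).eq_zero hu (z₀ := z₀) (by simp [hc])
  exact sub_eq_zero.1 (congrFun this z)

end SolvesPsi

/-- Solutions of `dφ = -αφ` are, up to a rotation, solutions of `dψ = αᵗψ`. -/
theorem SolvesPhi.rotate {u : ℂ → ℝ} {l : ℂ} {φ : ℂ → Fin 2 → ℂ} (h : SolvesPhi u l φ) :
    SolvesPsi u l (fun z => ![φ z 1, -φ z 0]) := by
  refine ⟨fun i => ?_, fun z i => ?_, fun z i => ?_⟩
  · fin_cases i
    · exact h.diff 1
    · exact (h.diff 0).neg
  · fin_cases i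
    · have := h.dz_eq z 1
      simp [alphaDz, Matrix.mulVec, dotProduct, Fin.sum_univ_two] at this ⊢
      rw [this]
    · have := h.dz_eq z 0
      simp [dz_eq_wirt, wirt_neg, alphaDz, Matrix.mulVec, dotProduct, Fin.sum_univ_two] at this ⊢
      rw [this]; ring
  · fin_cases i
    · have := h.dzbar_eq z 1
      simp [alphaDzbar, Matrix.mulVec, dotProduct, Fin.sum_univ_two] at this ⊢
      rw [this]
    · have := h.dzbar_eq z 0
      simp [dzbar_eq_wirt, wirt_neg, alphaDzbar, Matrix.mulVec, dotProduct,
        Fin.sum_univ_two] at this ⊢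
      rw [this]; ring

theorem SolvesPhi.ne_zero {u : ℂ → ℝ} {l : ℂ} {φ : ℂ → Fin 2 → ℂ} (hu : ContDiff ℝ ∞ u)
    (h : SolvesPhi u l φ) (hne : φ ≠ 0) (z : ℂ) : φ z ≠ 0 := by
  intro h0
  have := h.rotate.eq_zero hu (z₀ := z) (by simp [h0])
  refine hne (funext fun w => ?_)
  have := congrFun this w
  ext i
  fin_cases i
  · simpa using congrFun this 1
  · simpa using congrFun this 0

/-! ### Power series -/

/-- `∑ a_n x^n = f(x)` on the punctured disc of radius `R`. -/
def HasSeries (R : ℝ) (a : ℕ → ℂ) (f : ℂ → ℂ) : Prop :=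
  ∀ x : ℂ, x ≠ 0 → ‖x‖ < R → HasSum (fun n => a n * x ^ n) (f x)

namespace HasSeries

variable {R : ℝ} {a b : ℕ → ℂ} {f g : ℂ → ℂ}

theorem add (hf : HasSeries R a f) (hg : HasSeries R b g) :
    HasSeries R (fun n => a n + b n) (fun x => f x + g x) := fun x h0 hx => by
  simpa [add_mul] using (hf x h0 hx).add (hg x h0 hx)

theorem const_mul (c : ℂ) (hf : HasSeries R a f) :
    HasSeries R (fun n => c * a n) (fun x => c * f x) := fun x h0 hx => by
  simpa [mul_assoc] using (hf x h0 hx).mul_left c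

theorem congr (hf : HasSeries R a f) (h : ∀ x, x ≠ 0 → ‖x‖ < R → f x = g x) :
    HasSeries R a g := fun x h0 hx => by
  rw [← h x h0 hx]; exact hf x h0 hx

/-- Multiplication by the variable. -/
theorem shift (hf : HasSeries R a f) :
    HasSeries R (fun n => if n = 0 then 0 else a (n - 1)) (fun x => x * f x) := fun x h0 hx => by
  rw [← hasSum_nat_add_iff' 1]
  simpa [pow_succ, mul_assoc, mul_comm, mul_left_comm] using (hf x h0 hx).mul_left x

theorem mul (hf : HasSeries R a f) (hg : HasSeries R b g) :
    HasSeries R (fun n => ∑ k ∈ Finset.range (n + 1), a k * b (n - k))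
      (fun x => f x * g x) := fun x h0 hx => by
  have ha := (hf x h0 hx).summable.norm
  have hb := (hg x h0 hx).summable.norm
  have h := tsum_mul_tsum_eq_tsum_sum_range_of_summable_norm ha hb
  have hs := (summable_norm_sum_mul_range_of_summable_norm ha hb).of_norm
  rw [(hf x h0 hx).tsum_eq, (hg x h0 hx).tsum_eq] at h
  simp only [h]
  suffices he : (fun n => (∑ k ∈ Finset.range (n + 1), a k * b (n - k)) * x ^ n) = fun n =>
      ∑ k ∈ Finset.range (n + 1), a k * x ^ k * (b (n - k) * x ^ (n - k)) by
    rw [he]; exact hs.hasSum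
  funext n
  rw [Finset.sum_mul]
  refine Finset.sum_congr rfl fun k hk => ?_
  rw [← Nat.add_sub_cancel' (Finset.mem_range_succ_iff.1 hk), pow_add]
  simp only [add_tsub_cancel_left]
  ring

/-- The series are only known on a punctured disc, because the function may be undefined or
irrelevant at `0`. The identity theorem is therefore applied to the sum of the difference series,
whose value at `0` is recovered by continuity. -/
theorem unique (hR : 0 < R) (hf : HasSeries R a f) (hg : HasSeries R b f) : a = b := by
  have hd := hf.add (hg.const_mul (-1))
  set d : ℕ → ℂ := fun n => a n + -1 * b n with hd'
  let p := FormalMultilinearSeries.ofScalars ℂ d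
  have hp : ∀ n, p.coeff n = d n := fun n => by simp [p]
  let F : ℂ → ℂ := fun x => ∑' n, d n * x ^ n
  have hball : ∀ᶠ x in nhds (0 : ℂ), ‖x‖ < R := by
    filter_upwards [Metric.ball_mem_nhds (0 : ℂ) hR] with x hx using by simpa using hx
  have hF0 : ∀ᶠ x in nhdsWithin (0 : ℂ) {0}ᶜ, F x = 0 := by
    filter_upwards [nhdsWithin_le_nhds hball, self_mem_nhdsWithin] with x hx h0
    rw [show F x = _ from (hd x h0 hx).tsum_eq]; ring
  have hFp : HasFPowerSeriesAt F p 0 := by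
    rw [hasFPowerSeriesAt_iff]
    filter_upwards [hball] with x hx
    have : Summable fun n => d n * x ^ n := by
      by_cases h0 : x = 0
      · subst h0
        exact (hasSum_single 0 fun n hn => by simp [hn]).summable
      · exact (hd x h0 hx).summable
    simp only [hp, smul_eq_mul, zero_add, mul_comm (x ^ _)]
    exact this.hasSum
  have hFz : F 0 = 0 := by
    have h1 : Filter.Tendsto F (nhdsWithin 0 {0}ᶜ) (nhds (F 0)) :=
      hFp.continuousAt.tendsto.mono_left nhdsWithin_le_nhds
    exact tendsto_nhds_unique h1
      (tendsto_const_nhds.congr' (hF0.mono fun x hx => hx.symm))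
  have hFe : F =ᶠ[nhds 0] 0 := by
    rw [eventually_nhdsWithin_iff] at hF0
    filter_upwards [hF0] with x hx
    by_cases h0 : x = 0
    · subst h0; exact hFz
    · exact hx h0
  have hp0 : p = 0 := (hFp.congr hFe).eq_zero
  funext n
  have := hp n
  rw [hp0, show (0 : FormalMultilinearSeries ℂ ℂ ℂ).coeff n = 0 from rfl] at this
  linear_combination -this

end HasSeries

/-! ### Formal solutions of `dA = [A, α]` -/

/-- The coefficients of the powers of `x = -l` of a formal power series
`A = ∑ (a_n, b_n; c_n, -a_n) (-l)^n` which solves `dA = [A, α_l]`. -/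
structure IsKillingSeries (u : ℂ → ℝ) (a b c : ℕ → ℂ → ℂ) : Prop where
  smooth_a : ∀ n, ContDiff ℝ ∞ (a n)
  smooth_b : ∀ n, ContDiff ℝ ∞ (b n)
  smooth_c : ∀ n, ContDiff ℝ ∞ (c n)
  a_zero : ∀ z, a 0 z = 0
  c_zero : ∀ z, c 0 z = 0
  dz_a : ∀ n z, dz (a n) z
    = (1 / 2) * (I * exp (-toC u z) * b n z + I * exp (toC u z) * c (n + 1) z)
  dz_b : ∀ n z, dz (b n) z = -(I * exp (toC u z) * a (n + 1) z) - dz (toC u) z * b n z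
  dz_c : ∀ n z, dz (c n) z = dz (toC u) z * c n z - I * exp (-toC u z) * a n z
  dzbar_a_succ : ∀ n z, dzbar (a (n + 1)) z
    = -(1 / 2) * (I * exp (toC u z) * b n z + I * exp (-toC u z) * c (n + 1) z)
  dzbar_b : ∀ n z, dzbar (b n) z = I * exp (-toC u z) * a n z + dzbar (toC u) z * b n z
  dzbar_c_succ : ∀ n z, dzbar (c (n + 1)) z
    = -(dzbar (toC u) z * c (n + 1) z) + I * exp (toC u z) * a n z

/-- A formal solution of `dA = [A, α_l]` with `-det A = l / 4` and upper right entry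
`½ e^u + O(l)` at the origin. -/
structure IsNormalizedKillingSeries (u : ℂ → ℝ) (a b c : ℕ → ℂ → ℂ) : Prop
    extends IsKillingSeries u a b c where
  det_eq : ∀ n z, ∑ k ∈ Finset.range (n + 1), (a k z * a (n - k) z + b k z * c (n - k) z)
    = if n = 1 then -1 / 4 else 0
  b_zero_origin : b 0 0 = exp (toC u 0) / 2

theorem Finset.sum_Icc_one_eq_sum_range (f : ℕ → ℂ) (n : ℕ) :
    ∑ k ∈ Finset.Icc 1 n, f k = ∑ k ∈ Finset.range n, f (k + 1) := by
  induction n with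
  | zero => simp
  | succ n ih => rw [Finset.sum_Icc_succ_top (by omega), ih, Finset.sum_range_succ]

namespace IsKillingSeries

variable {u : ℂ → ℝ} {a b c : ℕ → ℂ → ℂ}

/-- The equation for `∂a_0` becomes algebraic because `a_0 = 0`. -/
theorem c_one (h : IsKillingSeries u a b c) (z : ℂ) :
    c 1 z = -(exp (-toC u z) * exp (-toC u z) * b 0 z) := by
  have h1 := h.dz_a 0 z
  rw [funext h.a_zero, dz_eq_wirt, wirt_const, zero_add] at h1
  have hE : exp (-toC u z) * exp (toC u z) = 1 := by rw [← exp_add]; simp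
  have hI : I ≠ 0 := I_ne_zero
  have h2 : exp (-toC u z) * b 0 z + exp (toC u z) * c 1 z = 0 := by
    have : I * (exp (-toC u z) * b 0 z + exp (toC u z) * c 1 z) = 0 := by
      linear_combination -2 * h1
    simpa using this
  linear_combination exp (-toC u z) * h2 - c 1 z * hE

end IsKillingSeries

/-! ### From a normalized formal Killing field to the Pinkall–Sterling iteration -/

namespace IsNormalizedKillingSeries

variable {u : ℂ → ℝ} {a b c : ℕ → ℂ → ℂ}

/-- The determinant condition at order one, together with `c_one`, gives `b_0² = e^{2u}/4`. The sign
cannot change on the connected plane, so it is fixed by the value at the origin. -/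
theorem b_zero (hu : ContDiff ℝ ∞ u) (h : IsNormalizedKillingSeries u a b c) (z : ℂ) :
    b 0 z = exp (toC u z) / 2 := by
  have hU := (contDiff_toC hu).continuous
  have hb := (h.smooth_b 0).continuous
  refine isPreconnected_univ.eq_of_sq_eq (f := b 0) (g := fun z => exp (toC u z) / 2)
    hb.continuousOn (by fun_prop) (fun w _ => ?_)
    (fun {w} _ => div_ne_zero (exp_ne_zero _) two_ne_zero) (Set.mem_univ 0) h.b_zero_origin
    (Set.mem_univ z)
  have h1 := h.det_eq 1 w
  have hE : exp (-toC u w) * exp (toC u w) = 1 := by rw [← exp_add]; simp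
  simp only [Finset.sum_range_succ, Finset.sum_range_zero, h.a_zero, h.c_zero, h.c_one] at h1
  simp at h1
  simp only [Pi.pow_apply]
  linear_combination (-exp (toC u w) ^ 2) * h1
    - b 0 w ^ 2 * (exp (-toC u w) * exp (toC u w) + 1) * hE

/-- The function `ϕ_n` of the iteration, in terms of the formal Killing field. -/
def phiCoeff (u : ℂ → ℝ) (b c : ℕ → ℂ → ℂ) (n : ℕ) (z : ℂ) : ℂ :=
  -(1 / 2) * (exp (-toC u z) * b n z - exp (toC u z) * c (n + 1) z)

theorem phiCoeff_zero (hu : ContDiff ℝ ∞ u) (h : IsNormalizedKillingSeries u a b c) (z : ℂ) :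
    phiCoeff u b c 0 z = -1 / 2 := by
  have hE : exp (-toC u z) * exp (toC u z) = 1 := by rw [← exp_add]; simp
  rw [phiCoeff, h.c_one, h.b_zero hu]
  linear_combination (-(1 / 4) - (1 / 4) * exp (-toC u z) * exp (toC u z) - 1/4) * hE

theorem dz_omega (h : IsNormalizedKillingSeries u a b c) (n : ℕ) (z : ℂ) :
    dz (fun w => -I * a n w) z
      = (1 / 2) * (exp (-toC u z) * b n z + exp (toC u z) * c (n + 1) z) := by
  rw [dz_eq_wirt, wirt_const_mul _ _ ((h.smooth_a n).differentiable (by simp) z), ← dz_eq_wirt,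
    h.dz_a]
  linear_combination (-(1 / 2) * (exp (-toC u z) * b n z + exp (toC u z) * c (n + 1) z)) * I_sq

theorem dzbar_omega_succ (h : IsNormalizedKillingSeries u a b c) (n : ℕ) (z : ℂ) :
    dzbar (fun w => -I * a (n + 1) w) z
      = -(1 / 2) * (exp (toC u z) * b n z + exp (-toC u z) * c (n + 1) z) := by
  rw [dzbar_eq_wirt, wirt_const_mul _ _ ((h.smooth_a _).differentiable (by simp) z),
    ← dzbar_eq_wirt, h.dzbar_a_succ]
  linear_combination ((1 / 2) * (exp (toC u z) * b n z + exp (-toC u z) * c (n + 1) z)) * I_sq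

/-- Since `ϕ_k` and `∂ω_k` are, up to sign, half the difference and half the sum of `e^{-u} b_k` and
`e^u c_{k+1}`, the products `ϕ_k ϕ_j - ∂ω_k ∂ω_j` equal `-½ (b_k c_{j+1} + b_j c_{k+1})`. Summed
over `k + j = n + 1` they give the `bc` part of the determinant at order `n + 2`. The two end terms
contribute `2 ϕ_0 ϕ_{n+1} = -ϕ_{n+1}`, which solves for `ϕ_{n+1}`. -/
theorem phiCoeff_succ (hu : ContDiff ℝ ∞ u) (h : IsNormalizedKillingSeries u a b c) (n : ℕ)
    (z : ℂ) : phiCoeff u b c (n + 1) z =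
      ∑ k ∈ Finset.Icc 1 n, (phiCoeff u b c k z * phiCoeff u b c (n + 1 - k) z
          - dz (fun w => -I * a k w) z * dz (fun w => -I * a (n + 1 - k) w) z)
        + ∑ k ∈ Finset.Icc 1 (n + 1), (-I * a k z) * (-I * a (n + 2 - k) z) := by
  have hE : exp (-toC u z) * exp (toC u z) = 1 := by rw [← exp_add]; simp
  have hp0 := h.phiCoeff_zero hu z
  have hd0 : dz (fun w => -I * a 0 w) z = 0 := by
    rw [show (fun w => -I * a 0 w) = fun _ => 0 from funext fun w => by rw [h.a_zero]; ring,
      dz_eq_wirt, wirt_const]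
  have hdet := h.det_eq (n + 2) z
  rw [if_neg (by omega), Finset.sum_add_distrib] at hdet
  have hbc : ∑ k ∈ Finset.range (n + 2 + 1), b k z * c (n + 2 - k) z
      = ∑ k ∈ Finset.range (n + 2), b k z * c (n + 2 - k) z := by
    rw [Finset.sum_range_succ, Nat.sub_self, h.c_zero, mul_zero, add_zero]
  -- Reversing the summation identifies the two halves of the symmetrized sum below.
  have hflip := Finset.sum_flip (n := n + 1) (fun k => b k z * c (n + 2 - k) z)
  have hPD : ∑ k ∈ Finset.range (n + 2),
      (phiCoeff u b c k z * phiCoeff u b c (n + 1 - k) z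
          - dz (fun w => -I * a k w) z * dz (fun w => -I * a (n + 1 - k) w) z)
      = -∑ k ∈ Finset.range (n + 2), b k z * c (n + 2 - k) z := by
    have : ∑ k ∈ Finset.range (n + 2),
      (phiCoeff u b c k z * phiCoeff u b c (n + 1 - k) z
          - dz (fun w => -I * a k w) z * dz (fun w => -I * a (n + 1 - k) w) z)
      = -(1 / 2) * (∑ k ∈ Finset.range (n + 2), b k z * c (n + 2 - k) z
        + ∑ k ∈ Finset.range (n + 2), b (n + 1 - k) z * c (n + 2 - (n + 1 - k)) z) := by
      rw [← Finset.sum_add_distrib, Finset.mul_sum]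
      refine Finset.sum_congr rfl fun k hk => ?_
      have hk' : k ≤ n + 1 := Finset.mem_range_succ_iff.1 hk
      rw [h.dz_omega, h.dz_omega, phiCoeff, phiCoeff, show n + 1 - k + 1 = n + 2 - k by omega,
        show n + 2 - (n + 1 - k) = k + 1 by omega]
      linear_combination (-(1 / 2) * (b k z * c (n + 2 - k) z + b (n + 1 - k) z * c (k + 1) z)) * hE
    rw [this, hflip]; ring
  rw [Finset.sum_range_succ, Finset.sum_range_succ'] at hPD
  rw [Finset.sum_range_succ, Finset.sum_range_succ'] at hdet
  simp only [Finset.sum_Icc_one_eq_sum_range]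
  have hWW : ∑ k ∈ Finset.range (n + 1), -I * a (k + 1) z * (-I * a (n + 2 - (k + 1)) z)
      = -∑ k ∈ Finset.range (n + 1), a (k + 1) z * a (n + 2 - (k + 1)) z := by
    rw [← Finset.sum_neg_distrib]
    refine Finset.sum_congr rfl fun k _ => ?_
    linear_combination (a (k + 1) z * a (n + 2 - (k + 1)) z) * I_sq
  rw [hWW]
  simp only [hp0, hd0, Nat.sub_self, Nat.sub_zero] at hPD
  simp only [Nat.sub_self, h.a_zero] at hdet
  rw [hbc] at hdet
  linear_combination -hPD + hdet

theorem isPinkallSterlingIteration (hu : ContDiff ℝ ∞ u)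
    (h : IsNormalizedKillingSeries u a b c) :
    IsPinkallSterlingIteration u (fun n z => -I * a n z) (fun n z => exp (-toC u z) * b n z)
      (fun n z => -exp (-toC u z) * c n z) (phiCoeff u b c) := by
  have hUs := contDiff_toC hu
  have hU : Differentiable ℝ (toC u) := hUs.differentiable (by simp)
  have hb : ∀ n, Differentiable ℝ (b n) := fun n => (h.smooth_b n).differentiable (by simp)
  have hc : ∀ n, Differentiable ℝ (c n) := fun n => (h.smooth_c n).differentiable (by simp)
  have hE : ∀ z, exp (-toC u z) * exp (toC u z) = 1 := fun z => by rw [← exp_add]; simp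
  have hE2 : ∀ z, exp (-2 * toC u z) = exp (-toC u z) ^ 2 := fun z => by
    rw [← exp_nat_mul]; congr 1; push_cast; ring
  have hF2 : ∀ z, exp (2 * toC u z) = exp (toC u z) ^ 2 := fun z => by
    rw [← exp_nat_mul]; congr 1
  have hcosh : ∀ z, cosh (2 * toC u z) = (exp (toC u z) ^ 2 + exp (-toC u z) ^ 2) / 2 :=
    fun z => by rw [cosh, hF2, ← hE2, neg_mul]
  have hsinh : ∀ z, sinh (2 * toC u z) = (exp (toC u z) ^ 2 - exp (-toC u z) ^ 2) / 2 :=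
    fun z => by rw [sinh, hF2, ← hE2, neg_mul]
  have hmul : ∀ (e : ℂ) {f : ℂ → ℂ} (_ : Differentiable ℝ f) z,
      wirt e (fun w => exp (toC u w) * f w) z
        = exp (toC u z) * (wirt e (toC u) z * f z + wirt e f z) := fun e f hf z => by
    rw [wirt_mul e (hU z).cexp (hf z), wirt_exp e (hU z)]; ring
  have hmul' : ∀ (e : ℂ) {f : ℂ → ℂ} (_ : Differentiable ℝ f) z,
      wirt e (fun w => exp (-toC u w) * f w) z
        = exp (-toC u z) * (-wirt e (toC u) z * f z + wirt e f z) := fun e f hf z => by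
    rw [wirt_mul e (hU z).fun_neg.cexp (hf z), wirt_exp e (hU z).fun_neg, wirt_neg]; ring
  have hdif1 : ∀ {f : ℂ → ℂ}, Differentiable ℝ f → ∀ z,
      DifferentiableAt ℝ (fun w => exp (toC u w) * f w) z := fun hf z => (hU z).cexp.fun_mul (hf z)
  have hdif2 : ∀ {f : ℂ → ℂ}, Differentiable ℝ f → ∀ z,
      DifferentiableAt ℝ (fun w => exp (-toC u w) * f w) z :=
    fun hf z => (hU z).fun_neg.cexp.fun_mul (hf z)
  have hphi : ∀ e n z, wirt e (phiCoeff u b c n) z = -(1 / 2) *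
      (exp (-toC u z) * (-wirt e (toC u) z * b n z + wirt e (b n) z)
        - exp (toC u z) * (wirt e (toC u) z * c (n + 1) z + wirt e (c (n + 1)) z)) :=
    fun e n z => by
      rw [← hmul e (hc _), ← hmul' e (hb _), ← wirt_sub e (hdif2 (hb _) z) (hdif1 (hc _) z),
        ← wirt_const_mul e _ ((hdif2 (hb _) z).fun_sub (hdif1 (hc _) z))]
      rfl
  have hddz : ∀ e n z, wirt e (dz (fun w => -I * a n w)) z = (1 / 2) *
      (exp (-toC u z) * (-wirt e (toC u) z * b n z + wirt e (b n) z)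
        + exp (toC u z) * (wirt e (toC u) z * c (n + 1) z + wirt e (c (n + 1)) z)) :=
    fun e n z => by
      rw [funext (h.dz_omega n), ← hmul e (hc _), ← hmul' e (hb _),
        ← wirt_add e (hdif2 (hb _) z) (hdif1 (hc _) z),
        ← wirt_const_mul e _ ((hdif2 (hb _) z).fun_add (hdif1 (hc _) z))]
  have hdzbar2 : ∀ e n z, wirt e (dzbar (fun w => -I * a (n + 1) w)) z = -(1 / 2) *
      (exp (toC u z) * (wirt e (toC u) z * b n z + wirt e (b n) z)
        + exp (-toC u z) * (-wirt e (toC u) z * c (n + 1) z + wirt e (c (n + 1)) z)) :=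
    fun e n z => by
      rw [funext (h.dzbar_omega_succ n), ← hmul' e (hc _), ← hmul e (hb _),
        ← wirt_add e (hdif1 (hb _) z) (hdif2 (hc _) z),
        ← wirt_const_mul e _ ((hdif1 (hb _) z).fun_add (hdif2 (hc _) z))]
  have hsig : ∀ e n z, wirt e (fun z => -exp (-toC u z) * c n z) z
      = -(exp (-toC u z) * (-wirt e (toC u) z * c n z + wirt e (c n) z)) := fun e n z => by
    rw [← hmul' e (hc n), ← wirt_neg]; simp only [neg_mul]
  -- With `b_0 = ½ e^u` known, the equation for `∂b_0` determines `a_1`.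
  have homega1 : ∀ z, -I * a 1 z = dz (toC u) z := fun z => by
    have h1 := h.dz_b 0 z
    rw [funext (h.b_zero hu), show (fun z => exp (toC u z) / 2)
      = fun z => exp (toC u z) * (1 / 2) from funext fun z => by ring, dz_eq_wirt,
      hmul _ (differentiable_const _), wirt_const, ← dz_eq_wirt] at h1
    simp only [zero_add] at h1
    linear_combination -exp (-toC u z) * h1 + (dz (toC u) z + I * a 1 z) * hE z
  have hphi1 : ∀ z, phiCoeff u b c 1 z = dz (toC u) z ^ 2 := fun z => by
    rw [h.phiCoeff_succ hu 0 z]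
    simp [← homega1]
    ring
  have hdzb : ∀ n z, wirt (-I) (b n) z = _ := fun n z =>
    (congrFun (congrFun dz_eq_wirt.symm (b n)) z).trans (h.dz_b n z)
  have hdzc : ∀ n z, wirt (-I) (c n) z = _ := fun n z =>
    (congrFun (congrFun dz_eq_wirt.symm (c n)) z).trans (h.dz_c n z)
  have hdbb : ∀ n z, wirt I (b n) z = _ := h.dzbar_b
  have hdbc : ∀ n z, wirt I (c (n + 1)) z = _ := h.dzbar_c_succ
  have hdu : wirt (-I) (toC u) = dz (toC u) := by rw [dz_eq_wirt]
  have hdu' : wirt I (toC u) = dzbar (toC u) := rfl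
  have hdzdz : ∀ n z, dz (dz (fun w => -I * a n w)) z = _ := fun n z =>
    (congrFun (congrFun dz_eq_wirt _) z).trans (hddz (-I) n z)
  have hdbdb : ∀ n z, dzbar (dzbar (fun w => -I * a (n + 1) w)) z = _ := hdzbar2 I
  have htau : ∀ n z, exp (-toC u z) * b n z
      = dz (fun w => -I * a n w) z - phiCoeff u b c n z := fun n z => by
    rw [h.dz_omega, phiCoeff]; ring
  have homega : ∀ n z, -I * a (n + 1) z = dz (fun z => exp (-toC u z) * b n z) z
      + 2 * (exp (-toC u z) * b n z) * dz (toC u) z := fun n z => by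
    rw [dz_eq_wirt, hmul' _ (hb n), hdzb, hdu]
    linear_combination (I * a (n + 1) z) * hE z
  refine ⟨fun n => ⟨?_, ?_, ?_, ?_⟩, homega1, hphi1, fun z => ?_, fun n z => ?_, homega, htau,
    fun n z => ?_, fun n z => ?_, fun n z => ?_, fun n z => ?_, fun n z => ?_, fun n z => ?_,
    fun n z => ?_⟩
  · exact contDiff_const.mul (h.smooth_a n)
  · exact hUs.neg.cexp.mul (h.smooth_b n)
  · exact hUs.neg.cexp.neg.mul (h.smooth_c n)
  · exact contDiff_const.mul
      ((hUs.neg.cexp.mul (h.smooth_b n)).sub (hUs.cexp.mul (h.smooth_c (n + 1))))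
  · have hd1 := contDiff_wirt (-I) hUs
    have hd2 := (contDiff_wirt (-I) hd1).differentiable (by simp) z
    have hd1' := hd1.differentiable (by simp) z
    -- `τ_1 = ∂²u - (∂u)²`; one more step of the iteration yields `ω_2`.
    have ht : ∀ w, exp (-toC u w) * b 1 w = dz (dz (toC u)) w - dz (toC u) w * dz (toC u) w :=
      fun w => by rw [htau, hphi1, funext homega1]; ring
    rw [homega 1 z, funext ht, ht, dz_eq_wirt, wirt_sub _ hd2 (hd1'.fun_mul hd1'),
      wirt_mul _ hd1' hd1']
    ring
  · rw [dzbar_eq_wirt, hddz, hdbb, hdbc, hdu', hcosh]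
    ring
  · rw [hdzdz, h.dz_omega, dz_eq_wirt, hmul' _ (hb n), hdzb, hdzc, ← dz_eq_wirt]
    ring
  · rw [dzbar_eq_wirt, hmul' _ (hb n), hdbb, hdu', hE2]
    ring
  · rw [h.dz_omega, dz_eq_wirt, hphi, hdzb, hdzc, hdu]
    ring
  · rw [dzbar_eq_wirt, hphi, hdbb, hdbc, hdu', hsinh]
    ring
  · rw [h.dz_omega, phiCoeff, hE2]
    linear_combination (exp (-toC u z) * c (n + 1) z) * hE z
  · rw [dz_eq_wirt, hsig, hdzc, hdu, hE2]
    ring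
  -- The formula for `∂̄a_n` involves `b_{n-1}`, so the index `0`, where everything vanishes, is
  -- separate.
  · cases n with
    | zero =>
      simp [funext h.a_zero, funext h.c_zero, dzbar_eq_wirt, wirt_const,
        show wirt I (fun _ => (0 : ℂ)) = fun _ => 0 from funext fun z => wirt_const I 0 z]
    | succ n =>
      rw [hdbdb, h.dzbar_omega_succ, dzbar_eq_wirt, hsig, hdbb, hdbc, hdu']
      ring

/-- Both sides obey the same recursion with the same initial values. At each stage `ω_{n+1}` has to
be identified before `ϕ_{n+1}`, whose recursion involves it. -/
theorem psOmega_psPhi_eq (hu : ContDiff ℝ ∞ u) (h : IsNormalizedKillingSeries u a b c) (n : ℕ) :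
    psOmega u n = (fun z => -I * a n z) ∧ psPhi u n = phiCoeff u b c n := by
  have hi := h.isPinkallSterlingIteration hu
  induction n using Nat.strong_induction_on with
  | _ n ih =>
    cases n with
    | zero =>
      refine ⟨?_, ?_⟩
      · rw [psOmega_zero]; funext z; rw [h.a_zero]; ring
      · rw [psPhi_zero]; funext z; rw [h.phiCoeff_zero hu]
    | succ n =>
      have hw : psOmega u (n + 1) = fun z => -I * a (n + 1) z := by
        have ht : psTau u n = fun z => exp (-toC u z) * b n z := by
          funext z
          rw [psTau, (ih n (by omega)).1, (ih n (by omega)).2, hi.tau_eq]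
        rw [psOmega_succ, ht]
        funext z
        rw [hi.omega_succ]
      have hw' : ∀ k ≤ n + 1, psOmega u k = fun z => -I * a k z := fun k hk => by
        rcases hk.lt_or_eq with hk | rfl
        · exact (ih k hk).1
        · exact hw
      refine ⟨hw, ?_⟩
      rw [psPhi_succ]
      funext z
      rw [h.phiCoeff_succ hu]
      congr 1
      · refine Finset.sum_congr rfl fun k hk => ?_
        rw [Finset.mem_Icc] at hk
        rw [(ih k (by omega)).2, (ih (n + 1 - k) (by omega)).2, (ih k (by omega)).1,
          (ih (n + 1 - k) (by omega)).1]
      · refine Finset.sum_congr rfl fun k hk => ?_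
        rw [Finset.mem_Icc] at hk
        rw [hw' k (by omega), hw' (n + 2 - k) (by omega)]

theorem psOmega_eq (hu : ContDiff ℝ ∞ u) (h : IsNormalizedKillingSeries u a b c) :
    psOmega u = fun n z => -I * a n z := funext fun n => (h.psOmega_psPhi_eq hu n).1

theorem psPhi_eq (hu : ContDiff ℝ ∞ u) (h : IsNormalizedKillingSeries u a b c) :
    psPhi u = phiCoeff u b c := funext fun n => (h.psOmega_psPhi_eq hu n).2

theorem psTau_eq (hu : ContDiff ℝ ∞ u) (h : IsNormalizedKillingSeries u a b c) :
    psTau u = fun n z => exp (-toC u z) * b n z := by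
  funext n z
  rw [psTau, h.psOmega_eq hu, h.psPhi_eq hu, (h.isPinkallSterlingIteration hu).tau_eq]

theorem psSigma_eq (hu : ContDiff ℝ ∞ u) (h : IsNormalizedKillingSeries u a b c) :
    psSigma u = fun n z => -exp (-toC u z) * c n z := by
  funext n z
  cases n with
  | zero => rw [psSigma, h.c_zero]; ring
  | succ n =>
    rw [psSigma, h.psOmega_eq hu, h.psPhi_eq hu, (h.isPinkallSterlingIteration hu).sigma_succ]

end IsNormalizedKillingSeries

/-- The coefficients of a convergent solution of `dX = [X, α_l]`, `l = -x`, are a formal solution. -/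
theorem isKillingSeries_of_hasSeries {u : ℂ → ℝ} {R : ℝ} (hR : 0 < R) {a b c : ℕ → ℂ → ℂ}
    {X : ℂ → ℂ → Matrix (Fin 2) (Fin 2) ℂ}
    (sa : ∀ n, ContDiff ℝ ∞ (a n)) (sb : ∀ n, ContDiff ℝ ∞ (b n)) (sc : ∀ n, ContDiff ℝ ∞ (c n))
    (htr : ∀ x, x ≠ 0 → ∀ z, X x z 1 1 = -X x z 0 0)
    (ha : ∀ z, HasSeries R (fun n => a n z) (fun x => X x z 0 0))
    (hb : ∀ z, HasSeries R (fun n => b n z) (fun x => X x z 0 1))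
    (hc : ∀ z, HasSeries R (fun n => c n z) (fun x => X x z 1 0))
    (hda : ∀ e z, HasSeries R (fun n => wirt e (a n) z) (fun x => wirt e (fun w => X x w 0 0) z))
    (hdb : ∀ e z, HasSeries R (fun n => wirt e (b n) z) (fun x => wirt e (fun w => X x w 0 1) z))
    (hdc : ∀ e z, HasSeries R (fun n => wirt e (c n) z) (fun x => wirt e (fun w => X x w 1 0) z))
    (hdz : ∀ x, x ≠ 0 → ∀ z i j, dz (fun w => X x w i j) z
      = (X x z * alphaDz u (-x) z - alphaDz u (-x) z * X x z) i j)
    (hdzbar : ∀ x, x ≠ 0 → ∀ z i j, dzbar (fun w => X x w i j) z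
      = (X x z * alphaDzbar u (-x) z - alphaDzbar u (-x) z * X x z) i j) :
    IsKillingSeries u a b c := by
  rw [dz_eq_wirt] at hdz
  rw [dzbar_eq_wirt] at hdzbar
  -- The factor `l⁻¹ = -x⁻¹` in the `dz`-part of `α` is cleared by multiplying the first two
  -- equations by `x`, hence the shifts on their left sides.
  have e1 : ∀ z, _ := fun z => ((hda (-I) z).shift).unique hR <|
    (((hb z).shift.const_mul (1 / 2 * (I * exp (-toC u z)))).add
      ((hc z).const_mul (1 / 2 * (I * exp (toC u z))))).congr fun x hx _ => by
        rw [hdz x hx]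
        simp [alphaDz, Matrix.mul_apply, Matrix.vecMul, dotProduct, Fin.sum_univ_two]
        field_simp
        ring
  have e2 : ∀ z, _ := fun z => ((hdb (-I) z).shift).unique hR <|
    (((ha z).const_mul (-(I * exp (toC u z)))).add
      ((hb z).shift.const_mul (-dz (toC u) z))).congr fun x hx _ => by
        rw [hdz x hx]
        simp [alphaDz, Matrix.mul_apply, Matrix.vecMul, dotProduct, Fin.sum_univ_two,
          htr x hx]
        field_simp
        ring
  have e3 : ∀ z, _ := fun z => (hdc (-I) z).unique hR <|
    (((hc z).const_mul (dz (toC u) z)).add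
      ((ha z).const_mul (-(I * exp (-toC u z))))).congr fun x hx _ => by
        rw [hdz x hx]
        simp [alphaDz, Matrix.mul_apply, Matrix.vecMul, dotProduct, Fin.sum_univ_two,
          htr x hx]
        ring
  have e4 : ∀ z, _ := fun z => (hda I z).unique hR <|
    (((hb z).shift.const_mul (-(1 / 2) * (I * exp (toC u z)))).add
      ((hc z).const_mul (-(1 / 2) * (I * exp (-toC u z))))).congr fun x hx _ => by
        rw [hdzbar x hx]
        simp [alphaDzbar, Matrix.mul_apply, Matrix.vecMul, dotProduct, Fin.sum_univ_two]
        ring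
  have e5 : ∀ z, _ := fun z => (hdb I z).unique hR <|
    (((ha z).const_mul (I * exp (-toC u z))).add
      ((hb z).const_mul (dzbar (toC u) z))).congr fun x hx _ => by
        rw [hdzbar x hx]
        simp [alphaDzbar, Matrix.mul_apply, Matrix.vecMul, dotProduct, Fin.sum_univ_two,
          htr x hx]
        ring
  have e6 : ∀ z, _ := fun z => (hdc I z).unique hR <|
    (((hc z).const_mul (-dzbar (toC u) z)).add
      ((ha z).shift.const_mul (I * exp (toC u z)))).congr fun x hx _ => by
        rw [hdzbar x hx]
        simp [alphaDzbar, Matrix.mul_apply, Matrix.vecMul, dotProduct, Fin.sum_univ_two,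
          htr x hx]
        ring
  refine ⟨sa, sb, sc, fun z => ?_, fun z => ?_, fun n z => ?_, fun n z => ?_, fun n z => ?_,
    fun n z => ?_, fun n z => ?_, fun n z => ?_⟩
  -- The constant terms of the equations multiplied by `x` are what force `a_0 = 0` and `c_0 = 0`.
  · simpa using congrFun (e2 z) 0
  · simpa using congrFun (e1 z) 0
  · have := congrFun (e1 z) (n + 1)
    simp only [Nat.add_one_ne_zero, if_false, Nat.add_sub_cancel] at this
    rw [dz_eq_wirt, this]; ring
  · have := congrFun (e2 z) (n + 1)
    simp only [Nat.add_one_ne_zero, if_false, Nat.add_sub_cancel] at this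
    rw [dz_eq_wirt, this, dz_eq_wirt]; ring
  · rw [dz_eq_wirt, congrFun (e3 z) n, dz_eq_wirt]; ring
  · have := congrFun (e4 z) (n + 1)
    simp only [Nat.add_one_ne_zero, if_false, Nat.add_sub_cancel] at this
    rw [dzbar_eq_wirt, this]; ring
  · exact congrFun (e5 z) n
  · have := congrFun (e6 z) (n + 1)
    simp only [Nat.add_one_ne_zero, if_false, Nat.add_sub_cancel] at this
    rw [dzbar_eq_wirt, this, dzbar_eq_wirt]; ring

/-- A holomorphic square root, near the origin, of a function not vanishing there. -/
theorem exists_holomorphic_sqrt {p : ℂ → ℂ} (hp : Differentiable ℂ p) {m : ℂ} (hm : m ≠ 0)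
    (h0 : p 0 = m ^ 2) : ∃ R > 0, ∃ s : ℂ → ℂ, DifferentiableOn ℂ s (Metric.ball 0 R) ∧
      s 0 = m ∧ ∀ x ∈ Metric.ball (0 : ℂ) R, s x ≠ 0 ∧ s x ^ 2 = p x := by
  have hm2 : m ^ 2 ≠ 0 := pow_ne_zero 2 hm
  have hq : ∀ᶠ x in nhds (0 : ℂ), p x / m ^ 2 ∈ slitPlane := by
    have hc : ContinuousAt (fun x => p x / m ^ 2) 0 := (hp.continuous.div_const _).continuousAt
    refine hc.eventually_mem (isOpen_slitPlane.mem_nhds ?_)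
    simp [h0, hm2]
  obtain ⟨R, hR, hball⟩ := Metric.eventually_nhds_iff_ball.1 hq
  refine ⟨R, hR, fun x => m * exp (log (p x / m ^ 2) / 2), ?_, ?_, fun x hx => ⟨?_, ?_⟩⟩
  · have : DifferentiableOn ℂ (fun x => p x / m ^ 2) (Metric.ball 0 R) :=
      (hp.div_const _).differentiableOn
    exact (((this.clog hball).div_const 2).cexp).const_mul m
  · simp [h0, hm2]
  · exact mul_ne_zero hm (exp_ne_zero _)
  · rw [mul_pow, ← exp_nat_mul, Nat.cast_ofNat, mul_div_cancel₀ _ two_ne_zero,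
      exp_log (slitPlane_ne_zero (hball x hx))]
    field_simp

theorem DifferentiableOn.exists_hasSeries {f : ℂ → ℂ} {R : ℝ}
    (hf : DifferentiableOn ℂ f (Metric.ball 0 R)) :
    ∃ a : ℕ → ℂ, a 0 = f 0 ∧ HasSeries R a f := by
  refine ⟨fun n => (n.factorial : ℂ)⁻¹ * iteratedDeriv n f 0, by simp, fun x _ hx => ?_⟩
  have := Complex.hasSum_taylorSeries_on_ball hf (z := x) (by simpa using hx)
  simpa [mul_assoc, mul_comm, mul_left_comm] using this

theorem det_fin_two_traceless {M : Matrix (Fin 2) (Fin 2) ℂ} (h : M 1 1 = -M 0 0) :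
    M.det = -(M 0 0 ^ 2 + M 0 1 * M 1 0) := by
  rw [Matrix.det_fin_two, h]; ring

/-! ### Normalizing the polynomial Killing field -/

namespace IsPolynomialKillingField

variable {u : ℂ → ℝ} {g : ℕ} {ξ : ℂ → ℂ → Matrix (Fin 2) (Fin 2) ℂ}

theorem apply_one_one (h : IsPolynomialKillingField u g ξ) {l : ℂ} (hl : l ≠ 0) (z : ℂ) :
    ξ l z 1 1 = -ξ l z 0 0 := by
  have := h.trace_eq l hl z
  rw [Matrix.trace_fin_two] at this
  linear_combination this

/-- The coefficients of `l ξ` as a polynomial in `x = -l`. -/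
theorem exists_polynomial (h : IsPolynomialKillingField u g ξ) :
    ∃ C : Fin 2 → Fin 2 → ℕ → ℂ → ℂ, (∀ i j n, ContDiff ℝ ∞ (C i j n)) ∧
      (∃ k : ℂ, k ≠ 0 ∧ C 0 1 0 0 = k) ∧ (∀ i j n, g + 2 ≤ n → C i j n = 0) ∧
      ∀ x, x ≠ 0 → ∀ z i j,
        -x * ξ (-x) z i j = ∑ n ∈ Finset.range (g + 2), C i j n z * x ^ n := by
  obtain ⟨c, hc, ⟨k, hk, hk'⟩, hsum⟩ := h.laurent
  -- The factor `l` shifts the exponents to start at `0`, and `l = -x` produces the sign.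
  -- Coefficients beyond the degree, arbitrary in the given family, are set to zero.
  refine ⟨fun i j n z => if n < g + 2 then (-1) ^ n * c n z i j else 0, fun i j n => ?_,
    ⟨k, hk, by simp [hk']⟩, fun i j n hn => by funext z; simp [hn], fun x hx z i j => ?_⟩
  · by_cases hn : n < g + 2
    · simpa only [hn, if_true] using contDiff_const.mul (hc n i j)
    · simpa only [hn, if_false] using contDiff_const
  · rw [hsum (-x) (neg_ne_zero.2 hx) z, Matrix.sum_apply, Finset.mul_sum]
    refine Finset.sum_congr rfl fun n hn => ?_
    beta_reduce
    rw [if_pos (Finset.mem_range.1 hn), Matrix.smul_apply, smul_eq_mul,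
      zpow_sub_one₀ (neg_ne_zero.2 hx), zpow_natCast, neg_pow x]
    field_simp

theorem differentiable (h : IsPolynomialKillingField u g ξ) {l : ℂ} (hl : l ≠ 0) (i j : Fin 2) :
    Differentiable ℝ fun z => ξ l z i j := by
  obtain ⟨c, hc, -, hsum⟩ := h.laurent
  have : (fun z => ξ l z i j)
      = fun z => ∑ n ∈ Finset.range (g + 2), l ^ ((n : ℤ) - 1) * c n z i j := by
    funext z
    rw [hsum l hl, Matrix.sum_apply]
    rfl
  rw [this]
  exact Differentiable.fun_sum fun n _ => ((hc n i j).differentiable (by simp)).const_mul _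

/-- The derivative of `det ξ` vanishes because `dξ` is a commutator with the traceless matrix `ξ`.
-/
theorem det_const (h : IsPolynomialKillingField u g ξ) {l : ℂ} (hl : l ≠ 0) (z w : ℂ) :
    (ξ l z).det = (ξ l w).det := by
  have hd := h.differentiable hl
  have hdet : ∀ z, (ξ l z).det = -(ξ l z 0 0 * ξ l z 0 0 + ξ l z 0 1 * ξ l z 1 0) := fun z => by
    rw [det_fin_two_traceless (h.apply_one_one hl z), sq]
  have key : ∀ e z, wirt e (fun z => (ξ l z).det) z
      = -(2 * ξ l z 0 0 * wirt e (fun w => ξ l w 0 0) z + ξ l z 1 0 * wirt e (fun w => ξ l w 0 1) z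
        + ξ l z 0 1 * wirt e (fun w => ξ l w 1 0) z) := fun e z => by
    rw [funext hdet, wirt_neg, wirt_add e ((hd 0 0 z).fun_mul (hd 0 0 z))
      ((hd 0 1 z).fun_mul (hd 1 0 z)), wirt_mul e (hd 0 0 z) (hd 0 0 z),
      wirt_mul e (hd 0 1 z) (hd 1 0 z)]
    ring
  refine eq_of_dz_dzbar_eq_zero (f := fun z => (ξ l z).det) ?_ (fun z => ?_) (fun z => ?_) z w
  · rw [funext hdet]
    exact (((hd 0 0).fun_mul (hd 0 0)).fun_add ((hd 0 1).fun_mul (hd 1 0))).fun_neg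
  · rw [dz_eq_wirt, key, ← dz_eq_wirt, h.dz_eq l hl, h.dz_eq l hl, h.dz_eq l hl]
    simp [alphaDz, Matrix.mul_apply, Matrix.vecMul, dotProduct, Fin.sum_univ_two,
          h.apply_one_one hl]
    ring
  · rw [dzbar_eq_wirt, key, ← dzbar_eq_wirt, h.dzbar_eq l hl, h.dzbar_eq l hl, h.dzbar_eq l hl]
    simp [alphaDzbar, Matrix.mul_apply, Matrix.vecMul, dotProduct, Fin.sum_univ_two,
          h.apply_one_one hl]
    ring

/-- The product of `l ξ` with a holomorphic function of `l = -x` is a formal solution. -/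
theorem isKillingSeries_mul (h : IsPolynomialKillingField u g ξ) {R : ℝ} (hR : 0 < R)
    {C : Fin 2 → Fin 2 → ℕ → ℂ → ℂ} (hC : ∀ i j n, ContDiff ℝ ∞ (C i j n))
    (hC0 : ∀ i j n, g + 2 ≤ n → C i j n = 0)
    (hCξ : ∀ x, x ≠ 0 → ∀ z i j,
        -x * ξ (-x) z i j = ∑ n ∈ Finset.range (g + 2), C i j n z * x ^ n)
    {f : ℂ → ℂ} {d : ℕ → ℂ} (hf : HasSeries R d f) (A : Fin 2 → Fin 2 → ℕ → ℂ → ℂ)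
    (hA : A = fun i j n z => ∑ k ∈ Finset.range (n + 1), C i j k z * d (n - k)) :
    (∀ i j z, HasSeries R (fun n => A i j n z) (fun x => -x * f x * ξ (-x) z i j)) ∧
      IsKillingSeries u (A 0 0) (A 0 1) (A 1 0) := by
  have hd : ∀ i j n, Differentiable ℝ (C i j n) := fun i j n => (hC i j n).differentiable (by simp)
  have hser : ∀ i j z, HasSeries R (fun n => C i j n z) (fun x => -x * ξ (-x) z i j) :=
    fun i j z x hx _ => by
      beta_reduce
      rw [hCξ x hx]
      exact hasSum_sum_of_ne_finset_zero fun n hn => by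
        rw [hC0 i j n (by simpa using hn)]; simp
  have hdser : ∀ e i j z, HasSeries R (fun n => wirt e (C i j n) z)
      (fun x => wirt e (fun w => -x * ξ (-x) w i j) z) := fun e i j z x hx _ => by
    simp only [hCξ x hx]
    have : wirt e (fun w => ∑ n ∈ Finset.range (g + 2), C i j n w * x ^ n) z
        = ∑ n ∈ Finset.range (g + 2), wirt e (C i j n) z * x ^ n := by
      rw [wirt_sum e _ fun n => (hd i j n z).mul_const _]
      refine Finset.sum_congr rfl fun n _ => ?_
      rw [wirt_mul e (hd i j n z) (differentiableAt_const _), wirt_const]; ring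
    rw [this]
    exact hasSum_sum_of_ne_finset_zero fun n hn => by
        rw [hC0 i j n (by simpa using hn)]; simp [show (0 : ℂ → ℂ) = fun _ => 0 from rfl, wirt_const]
  have hAs : ∀ i j n, ContDiff ℝ ∞ (A i j n) := fun i j n => by
    rw [hA]
    exact ContDiff.sum fun k _ => (hC i j k).mul contDiff_const
  have hAser : ∀ i j z, HasSeries R (fun n => A i j n z) (fun x => -x * f x * ξ (-x) z i j) :=
    fun i j z => by
      rw [hA]
      exact ((hser i j z).mul hf).congr fun x _ _ => by ring
  have hξd : ∀ x, x ≠ 0 → ∀ i j, Differentiable ℝ fun w => ξ (-x) w i j := fun x hx =>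
    h.differentiable (neg_ne_zero.2 hx)
  have hwd : ∀ e x, x ≠ 0 → ∀ i j z, wirt e (fun w => -x * f x * ξ (-x) w i j) z
      = -x * f x * wirt e (fun w => ξ (-x) w i j) z := fun e x hx i j z =>
    wirt_const_mul e _ (hξd x hx i j z)
  have hAd : ∀ e i j z, HasSeries R (fun n => wirt e (A i j n) z)
      (fun x => wirt e (fun w => -x * f x * ξ (-x) w i j) z) := fun e i j z => by
    have := (hdser e i j z).mul hf
    have he : (fun n => wirt e (A i j n) z)
        = fun n => ∑ k ∈ Finset.range (n + 1), wirt e (C i j k) z * d (n - k) := funext fun n => by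
      rw [hA, wirt_sum e _ fun k => (hd i j k z).mul_const _]
      refine Finset.sum_congr rfl fun k _ => ?_
      rw [wirt_mul e (hd i j k z) (differentiableAt_const _), wirt_const]; ring
    rw [he]
    refine this.congr fun x hx _ => ?_
    rw [hwd e x hx, wirt_const_mul e _ (hξd x hx i j z)]
    ring
  refine ⟨hAser, isKillingSeries_of_hasSeries hR (X := fun x z => (-x * f x) • ξ (-x) z)
    (hAs 0 0) (hAs 0 1) (hAs 1 0) (fun x hx z => ?_) (hAser 0 0) (hAser 0 1) (hAser 1 0)
    (fun e => hAd e 0 0) (fun e => hAd e 0 1) (fun e => hAd e 1 0) (fun x hx z i j => ?_)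
    (fun x hx z i j => ?_)⟩
  · simp [h.apply_one_one (neg_ne_zero.2 hx) z]
  · rw [dz_eq_wirt]
    refine (hwd (-I) x hx i j z).trans ?_
    rw [← dz_eq_wirt, h.dz_eq _ (neg_ne_zero.2 hx), Matrix.smul_mul, Matrix.mul_smul, ← smul_sub]
    rfl
  · rw [dzbar_eq_wirt]
    refine (hwd I x hx i j z).trans ?_
    rw [← dzbar_eq_wirt, h.dzbar_eq _ (neg_ne_zero.2 hx), Matrix.smul_mul, Matrix.mul_smul,
      ← smul_sub]
    rfl

/-- The factor `-x / (2 s)` gives the determinant `x²/(4 s²) · det ξ = x/4`, and the choice `s(0) =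
k e^{-u(0)}` gives `b_0 = ½ e^u` at the origin. -/
theorem exists_normalization (h : IsPolynomialKillingField u g ξ) :
    ∃ R > 0, ∃ s : ℂ → ℂ, ∃ a b c : ℕ → ℂ → ℂ, IsNormalizedKillingSeries u a b c ∧
      DifferentiableOn ℂ s (Metric.ball 0 R) ∧ (∀ x ∈ Metric.ball (0 : ℂ) R, s x ≠ 0) ∧
      (∀ x ∈ Metric.ball (0 : ℂ) R, x ≠ 0 → ∀ z, s x ^ 2 = x * (ξ (-x) z).det) ∧
      (∀ z, HasSeries R (fun n => a n z) (fun x => -x / (2 * s x) * ξ (-x) z 0 0)) ∧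
      (∀ z, HasSeries R (fun n => b n z) (fun x => -x / (2 * s x) * ξ (-x) z 0 1)) ∧
      (∀ z, HasSeries R (fun n => c n z) (fun x => -x / (2 * s x) * ξ (-x) z 1 0)) := by
  obtain ⟨C, hC, ⟨k, hk, hk'⟩, hC0, hCξ⟩ := h.exists_polynomial
  have hone : HasSeries 1 (fun n => if n = 0 then 1 else 0) (fun _ => (1 : ℂ)) := fun x _ _ => by
    convert hasSum_ite_eq 0 (1 : ℂ) using 2 with n
    split_ifs with hn <;> simp [hn]
  -- The unnormalized field `l ξ` (the case `f = 1`) is already a formal solution. This forces the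
  -- first column of its constant term to vanish and determines the lower left entry at order one.
  have hK := (h.isKillingSeries_mul one_pos hC hC0 hCξ hone C (by
    funext i j n z
    rw [Finset.sum_eq_single_of_mem n (by simp)]
    · simp
    · intro m hm hmn
      rw [if_neg, mul_zero]
      have := Finset.mem_range.1 hm
      omega)).2
  -- `l ξ = (x Y₀₀, X₀₁; x Y₁₀, -x Y₀₀)` at `z = 0`
  let Y : Fin 2 → ℂ → ℂ := fun i x => ∑ n ∈ Finset.range (g + 1), C i 0 (n + 1) 0 * x ^ n
  let Z : ℂ → ℂ := fun x => ∑ n ∈ Finset.range (g + 2), C 0 1 n 0 * x ^ n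
  -- As the first column of `l ξ` is divisible by `x`, dividing `det (l ξ)` by `x` leaves a
  -- polynomial, equal to `x det ξ(-x)` off the origin.
  let p : ℂ → ℂ := fun x => -(x * Y 0 x ^ 2 + Z x * Y 1 x)
  have hY : ∀ i, Differentiable ℂ (Y i) := fun i => by fun_prop
  have hZ : Differentiable ℂ Z := by fun_prop
  have hp : Differentiable ℂ p := by fun_prop
  have hC00 : ∀ i, C i 0 0 0 = 0 := fun i => by
    fin_cases i
    · exact hK.a_zero 0
    · exact hK.c_zero 0
  have hYξ : ∀ i x, x ≠ 0 → -x * ξ (-x) 0 i 0 = x * Y i x := fun i x hx => by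
    rw [hCξ x hx, Finset.sum_range_succ', hC00, zero_mul, add_zero, Finset.mul_sum]
    exact Finset.sum_congr rfl fun n _ => by ring
  have hZξ : ∀ x, x ≠ 0 → -x * ξ (-x) 0 0 1 = Z x := fun x hx => hCξ x hx 0 0 1
  have hpξ : ∀ x, x ≠ 0 → ∀ z, p x = x * (ξ (-x) z).det := fun x hx z => by
    rw [h.det_const (neg_ne_zero.2 hx) z 0,
      det_fin_two_traceless (h.apply_one_one (neg_ne_zero.2 hx) 0)]
    refine mul_left_cancel₀ hx ?_
    simp only [p]
    rw [← hZξ x hx]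
    linear_combination (x * Y 0 x - x * ξ (-x) 0 0 0) * hYξ 0 x hx
      - x * ξ (-x) 0 0 1 * hYξ 1 x hx
  have hm : k * exp (-toC u 0) ≠ 0 := mul_ne_zero hk (exp_ne_zero _)
  have hp0 : p 0 = (k * exp (-toC u 0)) ^ 2 := by
    have h1 : Y 1 0 = C 1 0 1 0 := by
      simp only [Y]
      rw [Finset.sum_range_succ']; simp
    have h2 : Z 0 = k := by
      simp only [Z]
      rw [Finset.sum_range_succ']; simp [hk']
    simp only [p]
    rw [h1, h2, hK.c_one, hk']
    ring
  obtain ⟨R, hR, s, hs, hs0, hsp⟩ := exists_holomorphic_sqrt hp hm hp0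
  have hinv : DifferentiableOn ℂ (fun x => (2 * s x)⁻¹) (Metric.ball 0 R) :=
    (hs.const_mul 2).fun_inv fun x hx => mul_ne_zero two_ne_zero (hsp x hx).1
  obtain ⟨d, hd0, hd⟩ := hinv.exists_hasSeries
  obtain ⟨hA, hAK⟩ := h.isKillingSeries_mul hR hC hC0 hCξ hd _ rfl
  set A : Fin 2 → Fin 2 → ℕ → ℂ → ℂ :=
    fun i j n z => ∑ k ∈ Finset.range (n + 1), C i j k z * d (n - k) with hAdef
  refine ⟨R, hR, s, A 0 0, A 0 1, A 1 0, ⟨hAK, fun n z => ?_, ?_⟩, hs, fun x hx => (hsp x hx).1,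
    fun x hx hx0 z => by rw [(hsp x hx).2, hpξ x hx0], hA 0 0, hA 0 1, hA 1 0⟩
  · have h1 := ((hA 0 0 z).mul (hA 0 0 z)).add ((hA 0 1 z).mul (hA 1 0 z))
    have h2 : HasSeries R (fun n => if n = 1 then -1 / 4 else 0) (fun x => -x / 4) :=
      fun x _ _ => by
        convert hasSum_ite_eq 1 (-x / 4 : ℂ) using 2 with n
        by_cases hn : n = 1
        · subst hn; simp; ring
        · simp [hn]
    have := congrFun (h1.unique hR (h2.congr fun x hx hxR => ?_)) n
    · simpa only [Finset.sum_add_distrib] using this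
    · have hxb : x ∈ Metric.ball (0 : ℂ) R := by simpa using hxR
      have hsx := (hsp x hxb).1
      have e1 := (hsp x hxb).2.trans (hpξ x hx z)
      rw [det_fin_two_traceless (h.apply_one_one (neg_ne_zero.2 hx) z)] at e1
      field_simp
      linear_combination (-4) * e1
  · rw [hAdef]
    simp [hk', hd0, hs0, exp_neg]
    field_simp

end IsPolynomialKillingField

/-! ### Periodic `u` -/

/-- The normalization at the origin survives translation since `b_0 = ½ e^u` holds everywhere. -/
theorem IsNormalizedKillingSeries.translate {u : ℂ → ℝ} {a b c : ℕ → ℂ → ℂ} {γ : ℂ}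
    (hu : ContDiff ℝ ∞ u) (hγ : ∀ z, u (z + γ) = u z) (h : IsNormalizedKillingSeries u a b c) :
    IsNormalizedKillingSeries u (fun n z => a n (z + γ)) (fun n z => b n (z + γ))
      (fun n z => c n (z + γ)) := by
  have hU : ∀ z, toC u (z + γ) = toC u z := fun z => by simp [toC, hγ]
  have hdU : ∀ z, dz (toC u) (z + γ) = dz (toC u) z := by
    rw [dz_eq_wirt]; exact wirt_periodic _ hU
  have hdU' : ∀ z, dzbar (toC u) (z + γ) = dzbar (toC u) z := wirt_periodic _ hU
  have ht : ContDiff ℝ ∞ fun z : ℂ => z + γ := contDiff_id.add contDiff_const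
  have hdz : ∀ (f : ℂ → ℂ) z, dz (fun w => f (w + γ)) z = dz f (z + γ) := by
    rw [dz_eq_wirt]; exact fun f z => wirt_comp_add_right _ f γ z
  have hdzbar : ∀ (f : ℂ → ℂ) z, dzbar (fun w => f (w + γ)) z = dzbar f (z + γ) :=
    fun f z => wirt_comp_add_right _ f γ z
  refine ⟨⟨fun n => (h.smooth_a n).comp ht, fun n => (h.smooth_b n).comp ht,
    fun n => (h.smooth_c n).comp ht, fun z => h.a_zero _, fun z => h.c_zero _, fun n z => ?_,
    fun n z => ?_, fun n z => ?_, fun n z => ?_, fun n z => ?_, fun n z => ?_⟩,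
    fun n z => h.det_eq n _, ?_⟩
  · rw [hdz, h.dz_a, hU]
  · rw [hdz, h.dz_b, hU, hdU]
  · rw [hdz, h.dz_c, hU, hdU]
  · rw [hdzbar, h.dzbar_a_succ, hU]
  · rw [hdzbar, h.dzbar_b, hU, hdU']
  · rw [hdzbar, h.dzbar_c_succ, hU, hdU']
  · rw [h.b_zero hu, hU]

/-- The series and its translate are both given by the iteration, which depends on `u` only. -/
theorem IsNormalizedKillingSeries.periodic {u : ℂ → ℝ} {a b c : ℕ → ℂ → ℂ} {γ : ℂ}
    (hu : ContDiff ℝ ∞ u) (hγ : ∀ z, u (z + γ) = u z) (h : IsNormalizedKillingSeries u a b c)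
    (n : ℕ) (z : ℂ) : a n (z + γ) = a n z ∧ b n (z + γ) = b n z ∧ c n (z + γ) = c n z := by
  have h' := h.translate hu hγ
  have e1 := congrFun (congrFun ((h'.psOmega_eq hu).symm.trans (h.psOmega_eq hu)) n) z
  have e2 := congrFun (congrFun ((h'.psTau_eq hu).symm.trans (h.psTau_eq hu)) n) z
  have e3 := congrFun (congrFun ((h'.psSigma_eq hu).symm.trans (h.psSigma_eq hu)) n) z
  refine ⟨mul_left_cancel₀ (neg_ne_zero.2 I_ne_zero) e1, mul_left_cancel₀ (exp_ne_zero _) e2,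
    mul_left_cancel₀ (neg_ne_zero.2 (exp_ne_zero _)) e3⟩

/-! ### Eigenvectors of traceless matrices -/

/-- The entries come from the identity `(ψᵗφ)(M + ν) = 2ν φψᵗ`, valid because `M` has the distinct
eigenvalues `±ν`. -/
theorem traceless_eigen_projector {M : Matrix (Fin 2) (Fin 2) ℂ} (htr : M 1 1 = -M 0 0) {ν : ℂ}
    (hν : ν ≠ 0) {ψ φ : Fin 2 → ℂ} (hψ : ψ ≠ 0) (hφ : φ ≠ 0) (hψM : ψ ᵥ* M = ν • ψ)
    (hMφ : M *ᵥ φ = ν • φ) :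
    ψ ⬝ᵥ φ ≠ 0 ∧ ψ 0 * φ 0 / (ψ ⬝ᵥ φ) - 1 / 2 = M 0 0 / (2 * ν) ∧
      ψ 1 * φ 1 / (ψ ⬝ᵥ φ) - 1 / 2 = -(M 0 0 / (2 * ν)) ∧
      ψ 1 * φ 0 / (ψ ⬝ᵥ φ) = M 0 1 / (2 * ν) ∧ ψ 0 * φ 1 / (ψ ⬝ᵥ φ) = M 1 0 / (2 * ν) := by
  have p0 := congrFun hψM 0
  have p1 := congrFun hψM 1
  have f0 := congrFun hMφ 0
  have f1 := congrFun hMφ 1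
  simp [Matrix.vecMul, Matrix.mulVec, dotProduct, Fin.sum_univ_two, htr] at p0 p1 f0 f1
  have hy : ψ ⬝ᵥ φ = ψ 0 * φ 0 + ψ 1 * φ 1 := by simp [dotProduct, Fin.sum_univ_two]
  rw [hy]
  have e1 : (ψ 0 * φ 0 + ψ 1 * φ 1) * (M 0 0 + ν) = 2 * ν * (ψ 0 * φ 0) := by
    linear_combination φ 0 * p0 - ψ 1 * f1
  have e2 : (ψ 0 * φ 0 + ψ 1 * φ 1) * (ν - M 0 0) = 2 * ν * (ψ 1 * φ 1) := by
    linear_combination φ 1 * p1 - ψ 0 * f0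
  have e3 : (ψ 0 * φ 0 + ψ 1 * φ 1) * M 0 1 = 2 * ν * (ψ 1 * φ 0) := by
    linear_combination φ 0 * p1 + ψ 1 * f0
  have e4 : (ψ 0 * φ 0 + ψ 1 * φ 1) * M 1 0 = 2 * ν * (ψ 0 * φ 1) := by
    linear_combination φ 1 * p0 + ψ 0 * f1
  have hν2 : 2 * ν ≠ 0 := mul_ne_zero two_ne_zero hν
  -- If `ψᵗφ` vanished, the identity would make all products `ψ_i φ_j` vanish, and so `ψ` or `φ`.
  have hne : ψ 0 * φ 0 + ψ 1 * φ 1 ≠ 0 := fun h0 => by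
    rw [h0] at e1 e2 e3 e4
    simp only [zero_mul, zero_eq_mul, hν2, false_or] at e1 e2 e3 e4
    simp only [mul_eq_zero] at e1 e2 e3 e4
    rcases e1 with h | h
    · rcases e3 with h' | h'
      · exact hψ (by ext i; fin_cases i <;> simp [h, h'])
      · rcases e4 with h'' | h''
        · rcases e2 with h3 | h3
          · exact hψ (by ext i; fin_cases i <;> simp [h, h3])
          · exact hφ (by ext i; fin_cases i <;> simp [h', h3])
        · exact hφ (by ext i; fin_cases i <;> simp [h', h''])
    · rcases e4 with h' | h'
      · rcases e2 with h3 | h3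
        · exact hψ (by ext i; fin_cases i <;> simp [h', h3])
        · exact hφ (by ext i; fin_cases i <;> simp [h, h3])
      · exact hφ (by ext i; fin_cases i <;> simp [h, h'])
  refine ⟨hne, ?_, ?_, ?_, ?_⟩
  · field_simp
    linear_combination -e1
  · field_simp
    linear_combination -e2
  · rw [div_eq_div_iff hne hν2]
    linear_combination -e3
  · rw [div_eq_div_iff hne hν2]
    linear_combination -e4

theorem sq_eq_neg_det_of_vecMul {M : Matrix (Fin 2) (Fin 2) ℂ} (htr : M 1 1 = -M 0 0) {ν : ℂ}
    {ψ : Fin 2 → ℂ} (hψ : ψ ≠ 0) (h : ψ ᵥ* M = ν • ψ) : ν ^ 2 = -M.det := by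
  have p0 := congrFun h 0
  have p1 := congrFun h 1
  simp [Matrix.vecMul, dotProduct, Fin.sum_univ_two, htr] at p0 p1
  rw [det_fin_two_traceless htr]
  by_cases h0 : ψ 0 = 0
  · have h1 : ψ 1 ≠ 0 := fun h1 => hψ (by ext i; fin_cases i <;> simp [h0, h1])
    refine mul_right_cancel₀ h1 ?_
    linear_combination (M 0 0 - ν) * p1 - M 0 1 * p0
  · refine mul_right_cancel₀ h0 ?_
    linear_combination (-M 0 0 - ν) * p0 - M 1 0 * p1

/-- The eigenspace of `ν` is a line, the other eigenvalue being `-ν ≠ ν`. -/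
theorem wronskian_eq_zero_of_vecMul {M : Matrix (Fin 2) (Fin 2) ℂ} (htr : M 1 1 = -M 0 0) {ν : ℂ}
    (hν : ν ≠ 0) {ψ χ : Fin 2 → ℂ} (hψ : ψ ᵥ* M = ν • ψ) (hχ : χ ᵥ* M = ν • χ) :
    ψ 0 * χ 1 - ψ 1 * χ 0 = 0 := by
  have p0 := congrFun hψ 0
  have p1 := congrFun hψ 1
  have q0 := congrFun hχ 0
  have q1 := congrFun hχ 1
  simp [Matrix.vecMul, dotProduct, Fin.sum_univ_two, htr] at p0 p1 q0 q1
  have : 2 * ν * (ψ 0 * χ 1 - ψ 1 * χ 0) = 0 := by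
    linear_combination -χ 1 * p0 + ψ 1 * q0 - ψ 0 * q1 + χ 0 * p1
  simpa [hν] using this

/-! ### The expansions -/

theorem HasHalfSeries.const_mul {κ : ℂ} {a : ℕ → ℂ} {v : ℂ} (h : HasHalfSeries κ a v) (c : ℂ) :
    HasHalfSeries κ (fun n => c * a n) (c * v) := by
  unfold HasHalfSeries at h ⊢
  rw [show (fun n => κ⁻¹ * (c * a n * (-κ ^ 2) ^ n)) = fun n => c * (κ⁻¹ * (a n * (-κ ^ 2) ^ n))
    from funext fun n => by ring]
  exact h.mul_left c

theorem HasHalfSeries.sub {κ : ℂ} {a b : ℕ → ℂ} {v w : ℂ} (h : HasHalfSeries κ a v)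
    (h' : HasHalfSeries κ b w) : HasHalfSeries κ (fun n => a n - b n) (v - w) := by
  unfold HasHalfSeries at h h' ⊢
  simpa only [sub_mul, mul_sub] using HasSum.sub h h'

theorem HasHalfSeries.tail {κ : ℂ} (hκ : κ ≠ 0) {a : ℕ → ℂ} {v : ℂ} (h : HasHalfSeries κ a v)
    (h0 : a 0 = 0) : HasHalfSeries κ (fun n => a (n + 1)) (-(κ ^ 2)⁻¹ * v) := by
  unfold HasHalfSeries at h ⊢
  rw [← hasSum_nat_add_iff' 1] at h
  simp only [Finset.sum_range_one, h0, zero_mul, mul_zero, sub_zero] at h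
  rw [show (fun n => κ⁻¹ * (a (n + 1) * (-κ ^ 2) ^ n))
    = fun n => -(κ ^ 2)⁻¹ * (κ⁻¹ * (a (n + 1) * (-κ ^ 2) ^ (n + 1)))
    from funext fun n => by field_simp; ring]
  exact h.mul_left _

theorem HasHalfSeries.of_eq {κ : ℂ} {a b : ℕ → ℂ} {v w : ℂ} (h : HasHalfSeries κ a v)
    (hab : ∀ n, a n = b n) (hvw : v = w) : HasHalfSeries κ b w := by
  rw [← hvw, ← funext hab]; exact h

theorem HasSeries.hasHalfSeries {R : ℝ} {a : ℕ → ℂ} {f : ℂ → ℂ} (h : HasSeries R a f) {κ : ℂ}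
    (hκ : κ ≠ 0) (hR : ‖κ ^ 2‖ < R) : HasHalfSeries κ a (κ⁻¹ * f (-κ ^ 2)) :=
  (h (-κ ^ 2) (neg_ne_zero.2 (pow_ne_zero 2 hκ)) (by rwa [norm_neg])).mul_left κ⁻¹

theorem dz_omegaFun {u : ℂ → ℝ} {l : ℂ} {ψ φ : ℂ → Fin 2 → ℂ} (hψ : SolvesPsi u l ψ)
    (hφ : SolvesPhi u l φ) (z : ℂ) : dz (omegaFun ψ φ) z
      = I * exp (-toC u z) * ψ z 1 * φ z 0 - I * l⁻¹ * exp (toC u z) * ψ z 0 * φ z 1 := by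
  have h : omegaFun ψ φ = fun z => ψ z 0 * φ z 0 - ψ z 1 * φ z 1 := rfl
  rw [h, dz_eq_wirt, wirt_sub _ ((hψ.diff 0 z).fun_mul (hφ.diff 0 z))
    ((hψ.diff 1 z).fun_mul (hφ.diff 1 z)), wirt_mul _ (hψ.diff 0 z) (hφ.diff 0 z),
    wirt_mul _ (hψ.diff 1 z) (hφ.diff 1 z), ← dz_eq_wirt, hψ.dz_eq, hψ.dz_eq, hφ.dz_eq, hφ.dz_eq]
  simp [alphaDz, Matrix.mulVec, dotProduct, Fin.sum_univ_two]
  ring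

theorem seriesExpansion_of_projector {u : ℂ → ℝ} (hu : ContDiff ℝ ∞ u) {Q : ℂ} (hQ : Q ≠ 0)
    {a b c : ℕ → ℂ → ℂ} (h : IsNormalizedKillingSeries u a b c) {κ : ℂ} (hκ : κ ≠ 0)
    {ψ φ : ℂ → Fin 2 → ℂ} (hψ : SolvesPsi u (κ ^ 2) ψ) (hφ : SolvesPhi u (κ ^ 2) φ) {z : ℂ}
    (hy : ψ z ⬝ᵥ φ z ≠ 0)
    (h00 : HasHalfSeries κ (fun n => a n z) (ψ z 0 * φ z 0 / (ψ z ⬝ᵥ φ z) - 1 / 2))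
    (h10 : HasHalfSeries κ (fun n => b n z) (ψ z 1 * φ z 0 / (ψ z ⬝ᵥ φ z)))
    (h01 : HasHalfSeries κ (fun n => c n z) (ψ z 0 * φ z 1 / (ψ z ⬝ᵥ φ z))) :
    SeriesExpansion u Q κ ψ φ z := by
  have hyd : ψ z ⬝ᵥ φ z = ψ z 0 * φ z 0 + ψ z 1 * φ z 1 := by simp [dotProduct, Fin.sum_univ_two]
  have hy' : ψ z 0 * φ z 0 + ψ z 1 * φ z 1 ≠ 0 := by rwa [← hyd]
  have hcQ : conj Q ≠ 0 := (map_ne_zero _).2 hQ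
  have hE : exp (toC u z) ≠ 0 := exp_ne_zero _
  have hE2 : exp (2 * toC u z) = exp (toC u z) ^ 2 := by rw [← exp_nat_mul]; congr 1
  have tau_eq : -(I * Q * tauFun u Q ψ φ z) / yFun ψ φ z
      = exp (-toC u z) * ψ z 1 * φ z 0 / yFun ψ φ z := by
    rw [tauFun, exp_neg]
    congr 1
    field_simp
    linear_combination (-ψ z 1 * φ z 0) * I_sq
  have sigma_eq : -(I * conj Q * sigmaFun u Q ψ φ z) / yFun ψ φ z
      = -exp (-toC u z) * ψ z 0 * φ z 1 / yFun ψ φ z := by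
    rw [sigmaFun, exp_neg]
    congr 1
    field_simp
    linear_combination (ψ z 0 * φ z 1) * I_sq
  have phi_eq' : -(I * phiFun u Q ψ φ z) / (2 * yFun ψ φ z)
      = (-exp (-toC u z) * ψ z 1 * φ z 0
        - (κ ^ 2)⁻¹ * exp (toC u z) * ψ z 0 * φ z 1) / (2 * yFun ψ φ z) := by
    rw [phiFun, dz_omegaFun hψ hφ, tauFun, exp_neg]
    congr 1
    field_simp
    linear_combination (κ ^ 2 * ψ z 1 * φ z 0 + exp (toC u z) ^ 2 * ψ z 0 * φ z 1) * I_sq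
  have phi_eq : -(I * phiFun u Q ψ φ z) / (2 * yFun ψ φ z)
      = (I * Q * tauFun u Q ψ φ z
        - I * (κ ^ 2)⁻¹ * exp (2 * toC u z) * conj Q * sigmaFun u Q ψ φ z)
          / (2 * yFun ψ φ z) := by
    rw [phi_eq', tauFun, sigmaFun, hE2, exp_neg]
    congr 1
    field_simp
    linear_combination (-κ ^ 2 * ψ z 1 * φ z 0 - exp (toC u z) ^ 2 * ψ z 0 * φ z 1) * I_sq
  -- `ϕ_n` contains `c_{n+1}`; dropping the zero term `c_0` turns this index shift into the factor
  -- `-l⁻¹`.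
  have hcc := h01.tail hκ (h.c_zero z)
  refine ⟨hy, ?_, tau_eq, ?_, sigma_eq, ?_, phi_eq, phi_eq', ?_, ?_, ?_, ?_, ?_⟩
  · rw [h.psOmega_eq hu]
    refine (h00.const_mul (-I)).of_eq (fun n => rfl) ?_
    rw [omegaFun, yFun, hyd]
    field_simp
    ring
  · rw [h.psTau_eq hu, tau_eq]
    exact (h10.const_mul (exp (-toC u z))).of_eq (fun n => rfl) (by rw [yFun]; ring)
  · rw [h.psSigma_eq hu, sigma_eq]
    exact (h01.const_mul (-exp (-toC u z))).of_eq (fun n => rfl) (by rw [yFun]; ring)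
  · rw [h.psPhi_eq hu, phi_eq']
    refine (((h10.const_mul (exp (-toC u z))).sub (hcc.const_mul (exp (toC u z)))).const_mul
      (-(1 / 2))).of_eq (fun n => rfl) ?_
    rw [yFun]
    field_simp
    ring
  · rw [h.psOmega_eq hu]
    refine h00.of_eq (fun n => ?_) ?_
    · linear_combination (a n z) * I_sq
    · simp [PMat, yFun, Matrix.vecMulVec_apply]; ring
  · rw [h.psOmega_eq hu]
    refine (h00.const_mul (-1)).of_eq (fun n => ?_) ?_
    · linear_combination (-a n z) * I_sq
    · simp only [PMat, yFun, Matrix.smul_apply, Matrix.vecMulVec_apply, smul_eq_mul]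
      rw [hyd]
      field_simp
      ring
  · rw [h.psSigma_eq hu]
    refine h01.of_eq (fun n => ?_) ?_
    · beta_reduce; rw [exp_neg]; field_simp
    · simp only [PMat, yFun, Matrix.smul_apply, Matrix.vecMulVec_apply, smul_eq_mul]; ring
  · rw [h.psTau_eq hu]
    refine h10.of_eq (fun n => ?_) ?_
    · beta_reduce; rw [exp_neg]; field_simp
    · simp only [PMat, yFun, Matrix.smul_apply, Matrix.vecMulVec_apply, smul_eq_mul]; ring

/-! ### Monodromy -/

namespace IsPolynomialKillingField

variable {u : ℂ → ℝ} {g : ℕ} {ξ : ℂ → ℂ → Matrix (Fin 2) (Fin 2) ℂ}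

/-- In `d(ψᵗξ) = ψᵗα ξ + ψᵗ[ξ, α] = ψᵗξ α` the terms with `α` on the left cancel. -/
theorem solvesPsi_vecMul (h : IsPolynomialKillingField u g ξ) {l : ℂ} (hl : l ≠ 0)
    {ψ : ℂ → Fin 2 → ℂ} (hψ : SolvesPsi u l ψ) : SolvesPsi u l fun z => ψ z ᵥ* ξ l z := by
  have he : ∀ i, (fun z => (ψ z ᵥ* ξ l z) i)
      = fun z => ψ z 0 * ξ l z 0 i + ψ z 1 * ξ l z 1 i := fun i => by
    funext z; simp [Matrix.vecMul, dotProduct, Fin.sum_univ_two]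
  have hd := h.differentiable hl
  have hw : ∀ e i z, wirt e (fun z => (ψ z ᵥ* ξ l z) i) z
      = wirt e (fun w => ψ w 0) z * ξ l z 0 i + ψ z 0 * wirt e (fun w => ξ l w 0 i) z
        + (wirt e (fun w => ψ w 1) z * ξ l z 1 i + ψ z 1 * wirt e (fun w => ξ l w 1 i) z) :=
    fun e i z => by
      rw [he, wirt_add e ((hψ.diff 0 z).fun_mul (hd 0 i z)) ((hψ.diff 1 z).fun_mul (hd 1 i z)),
        wirt_mul e (hψ.diff 0 z) (hd 0 i z), wirt_mul e (hψ.diff 1 z) (hd 1 i z)]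
  refine ⟨fun i => ?_, fun z i => ?_, fun z i => ?_⟩
  · rw [he]
    exact ((hψ.diff 0).fun_mul (hd 0 i)).fun_add ((hψ.diff 1).fun_mul (hd 1 i))
  · rw [dz_eq_wirt, hw, ← dz_eq_wirt, hψ.dz_eq, hψ.dz_eq, h.dz_eq l hl, h.dz_eq l hl]
    fin_cases i <;>
    · simp [alphaDz, Matrix.mul_apply, Matrix.mulVec, Matrix.vecMul, dotProduct, Fin.sum_univ_two]
      ring
  · rw [dzbar_eq_wirt, hw, ← dzbar_eq_wirt, hψ.dzbar_eq, hψ.dzbar_eq, h.dzbar_eq l hl,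
      h.dzbar_eq l hl]
    fin_cases i <;>
    · simp [alphaDzbar, Matrix.mul_apply, Matrix.mulVec, Matrix.vecMul, dotProduct,
        Fin.sum_univ_two]
      ring

/-- Simple eigenfunctions of the translation are eigenfunctions of a periodic Killing field. -/
theorem exists_vecMul_eq (hu : ContDiff ℝ ∞ u) (h : IsPolynomialKillingField u g ξ) {l : ℂ}
    (hl : l ≠ 0) {γ : ℂ} (hξγ : ∀ z, ξ l (z + γ) = ξ l z) {ψ : ℂ → Fin 2 → ℂ}
    (hψ : SolvesPsi u l ψ) (hne : ψ ≠ 0) {m : ℂ} (hm : m ^ 2 ≠ 1)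
    (hψm : ∀ z, ψ (z + γ) = m • ψ z) : ∃ ν : ℂ, ∀ z, ψ z ᵥ* ξ l z = ν • ψ z := by
  have hχ := h.solvesPsi_vecMul hl hψ
  refine hψ.eq_smul_of_wronskian hu hne hχ (z₀ := 0) ?_
  -- The Wronskian of `ψ` and `ψᵗξ` is constant, yet translation by `γ` multiplies it by `m² ≠ 1`,
  -- so it is zero.
  have hW := hψ.wronskian_const hχ (0 + γ) 0
  simp only [hψm, hξγ, Matrix.smul_vecMul, Pi.smul_apply, smul_eq_mul] at hW
  refine (mul_eq_zero.1 ?_).resolve_left (sub_ne_zero.2 hm)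
  linear_combination hW

end IsPolynomialKillingField

/-- The rotated `φ` solves the same system as `ψ`, with multiplier `μ⁻¹`, so both are left
eigenvectors of `ξ`, with eigenvalues of equal square. Equal eigenvalues would make them
proportional, hence `μ = μ⁻¹`. So the eigenvalues are opposite, and rotating back, which turns a
traceless matrix into minus its transpose, gives `ξφ = νφ`. -/
theorem exists_isBakerAkhiezerPair {u : ℂ → ℝ} (hu : ContDiff ℝ ∞ u) {g : ℕ}
    {ξ : ℂ → ℂ → Matrix (Fin 2) (Fin 2) ℂ} (h : IsPolynomialKillingField u g ξ) {l : ℂ}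
    (hl : l ≠ 0) {γ : ℂ} (hξγ : ∀ z, ξ l (z + γ) = ξ l z) (hdet : (ξ l 0).det ≠ 0)
    {μ : ℂ} (hμ1 : μ ≠ 1) (hμ2 : μ ≠ -1) {ψ φ : ℂ → Fin 2 → ℂ}
    (hm : IsMonodromyPair u γ l μ ψ φ) :
    ∃ ν : ℂ, ν ^ 2 = -(ξ l 0).det ∧ IsBakerAkhiezerPair u ξ l ν ψ φ := by
  have hμ0 : μ ≠ 0 := fun h0 => hm.psi.ne_zero hu hm.psi_ne (0 + γ) (by rw [hm.psi_mult, h0]; simp)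
  have hμ : μ ^ 2 ≠ 1 := fun h0 => ((sq_eq_sq_iff_eq_or_eq_neg (b := 1)).1 (by rw [h0, one_pow])).elim hμ1 hμ2
  have hμ' : μ⁻¹ ^ 2 ≠ 1 := by rwa [inv_pow, Ne, inv_eq_one]
  have htr := fun z => h.apply_one_one hl z
  set ρ : ℂ → Fin 2 → ℂ := fun z => ![φ z 1, -φ z 0] with hρ
  have hρs : SolvesPsi u l ρ := hm.phi.rotate
  have hρne : ρ ≠ 0 := fun h0 => hm.phi.ne_zero hu hm.phi_ne 0 (by
    have := congrFun h0 0
    ext i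
    fin_cases i
    · simpa [hρ] using congrFun this 1
    · simpa [hρ] using congrFun this 0)
  have hρm : ∀ z, ρ (z + γ) = μ⁻¹ • ρ z := fun z => by
    ext i
    fin_cases i <;> simp [hρ, hm.phi_mult]
  obtain ⟨ν, hν⟩ := h.exists_vecMul_eq hu hl hξγ hm.psi hm.psi_ne hμ hm.psi_mult
  obtain ⟨ν', hν'⟩ := h.exists_vecMul_eq hu hl hξγ hρs hρne hμ' hρm
  have e1 := sq_eq_neg_det_of_vecMul (htr 0) (hm.psi.ne_zero hu hm.psi_ne 0) (hν 0)
  have e2 := sq_eq_neg_det_of_vecMul (htr 0) (hρs.ne_zero hu hρne 0) (hν' 0)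
  have hν0 : ν ≠ 0 := fun h0 => hdet (by rw [h0] at e1; linear_combination e1)
  have hne : ν' ≠ ν := fun h0 => by
    rw [h0] at hν'
    obtain ⟨d, hd⟩ := hm.psi.eq_smul_of_wronskian hu hm.psi_ne hρs
      (wronskian_eq_zero_of_vecMul (htr 0) hν0 (hν 0) (hν' 0))
    have h1 : μ • ρ 0 = μ⁻¹ • ρ 0 := by
      rw [← hρm, hd, hd, hm.psi_mult, smul_comm]
    have h2 := smul_left_injective ℂ (hρs.ne_zero hu hρne 0) h1
    exact hμ (by rw [sq]; nth_rewrite 2 [h2]; exact mul_inv_cancel₀ hμ0)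
  have hneg : ν' = -ν := (sq_eq_sq_iff_eq_or_eq_neg.1 (e2.trans e1.symm)).resolve_left hne
  refine ⟨ν, e1, hm.psi, hm.phi, hm.psi_ne, hm.phi_ne, hν, fun z => ?_⟩
  have p0 := congrFun (hν' z) 0
  have p1 := congrFun (hν' z) 1
  simp [hρ, Matrix.vecMul, dotProduct, Fin.sum_univ_two, htr, hneg] at p0 p1
  ext i
  fin_cases i
  · simp [Matrix.mulVec, dotProduct, Fin.sum_univ_two]
    linear_combination p1
  · simp [Matrix.mulVec, dotProduct, Fin.sum_univ_two, htr]
    linear_combination -p0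

end

/-! ### The main theorem -/

theorem mainTheorem9 (u : ℂ → ℝ) (hu : IsSinhGordon u) (Q : ℂ) (hQ : Q ≠ 0) (g : ℕ)
    (ξ : ℂ → ℂ → Matrix (Fin 2) (Fin 2) ℂ) (hξ : IsPolynomialKillingField u g ξ) :
    IsPinkallSterlingIteration u (psOmega u) (psTau u) (psSigma u) (psPhi u) ∧
    ∃ r : ℝ, 0 < r ∧ ∃ ν : ℂ → ℂ,
      -- `κ ↦ (κ ^ 2, ν κ)` parametrizes the spectral curve over a punctured disc at `0`
      (∀ κ : ℂ, 0 < ‖κ‖ → ‖κ‖ < r →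
        AnalyticAt ℂ ν κ ∧ ν κ ≠ 0 ∧ ν (-κ) = -ν κ ∧ ∀ z, ν κ ^ 2 = -(ξ (κ ^ 2) z).det) ∧
      -- the expansions for the Baker-Akhiezer functions
      (∀ κ : ℂ, 0 < ‖κ‖ → ‖κ‖ < r → ∀ ψ φ : ℂ → Fin 2 → ℂ,
        IsBakerAkhiezerPair u ξ (κ ^ 2) (ν κ) ψ φ → ∀ z, SeriesExpansion u Q κ ψ φ z) ∧
      -- for periodic `u`: the expansions for the eigenfunctions of the monodromy
      (∀ γ : ℂ, (∀ z, u (z + γ) = u z) → ∀ l : ℂ, 0 < ‖l‖ → ‖l‖ < r ^ 2 →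
        ∀ (μ : ℂ) (ψ φ : ℂ → Fin 2 → ℂ), μ ≠ 1 → μ ≠ -1 → IsMonodromyPair u γ l μ ψ φ →
          ∃ κ : ℂ, κ ^ 2 = l ∧ IsBakerAkhiezerPair u ξ l (ν κ) ψ φ ∧
            ∀ z, SeriesExpansion u Q κ ψ φ z) := by
  obtain ⟨R, hR, s, a, b, c, h, hs, hs0, hsdet, ha, hb, hc⟩ := hξ.exists_normalization
  have hus := hu.smooth
  -- Since `s(-l)² = -l det ξ(l)`, dividing `s(-κ²)` by `κ` gives an odd root of `-det ξ(κ²)`. The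
  -- radius `√R` in `κ` corresponds to `R` in `l`.
  refine ⟨?_, √R, Real.sqrt_pos.2 hR, fun κ => s (-κ ^ 2) / κ, ?_⟩
  · rw [h.psOmega_eq hus, h.psTau_eq hus, h.psSigma_eq hus, h.psPhi_eq hus]
    exact h.isPinkallSterlingIteration hus
  have hball : ∀ κ : ℂ, ‖κ‖ < √R → ‖κ ^ 2‖ < R := fun κ hκ => by
    rw [norm_pow, ← Real.sq_sqrt hR.le]
    exact pow_lt_pow_left₀ hκ (norm_nonneg _) two_ne_zero
  have hmem : ∀ κ : ℂ, ‖κ‖ < √R → -κ ^ 2 ∈ Metric.ball (0 : ℂ) R := fun κ hκ => by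
    simpa using hball κ hκ
  have hcurve : ∀ κ : ℂ, 0 < ‖κ‖ → ‖κ‖ < √R →
      AnalyticAt ℂ (fun κ => s (-κ ^ 2) / κ) κ ∧ s (-κ ^ 2) / κ ≠ 0 ∧
        s (-(-κ) ^ 2) / -κ = -(s (-κ ^ 2) / κ) ∧
        ∀ z, (s (-κ ^ 2) / κ) ^ 2 = -(ξ (κ ^ 2) z).det := fun κ hκ0 hκ => by
    have hκ0' : κ ≠ 0 := norm_pos_iff.1 hκ0
    refine ⟨?_, div_ne_zero (hs0 _ (hmem κ hκ)) hκ0', by rw [neg_sq, div_neg], fun z => ?_⟩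
    · have h1 : AnalyticAt ℂ s (-κ ^ 2) :=
        hs.analyticAt (Metric.isOpen_ball.mem_nhds (hmem κ hκ))
      have h2 : AnalyticAt ℂ (fun κ : ℂ => -κ ^ 2) κ := (analyticAt_id.pow 2).neg
      exact (h1.comp (f := fun κ : ℂ => -κ ^ 2) h2).fun_div analyticAt_id hκ0'
    · rw [div_pow, hsdet _ (hmem κ hκ) (neg_ne_zero.2 (pow_ne_zero 2 hκ0')) z, neg_neg]
      field_simp
  have hexp : ∀ κ : ℂ, 0 < ‖κ‖ → ‖κ‖ < √R → ∀ ψ φ : ℂ → Fin 2 → ℂ,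
      IsBakerAkhiezerPair u ξ (κ ^ 2) (s (-κ ^ 2) / κ) ψ φ →
        ∀ z, SeriesExpansion u Q κ ψ φ z := fun κ hκ0 hκ ψ φ hBA z => by
    have hκ0' : κ ≠ 0 := norm_pos_iff.1 hκ0
    have hsκ := hs0 _ (hmem κ hκ)
    obtain ⟨hy, h00, -, h10, h01⟩ := traceless_eigen_projector
      (hξ.apply_one_one (pow_ne_zero 2 hκ0') z) (hcurve κ hκ0 hκ).2.1
      (hBA.psi.ne_zero hus hBA.psi_ne z) (hBA.phi.ne_zero hus hBA.phi_ne z)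
      (hBA.psi_eig z) (hBA.phi_eig z)
    -- The normalized series, divided by `κ`, is exactly `ξ/(2ν)`.
    have hval : ∀ m : ℂ, κ⁻¹ * (- -κ ^ 2 / (2 * s (-κ ^ 2)) * m) = m / (2 * (s (-κ ^ 2) / κ)) :=
      fun m => by rw [neg_neg]; field_simp
    refine seriesExpansion_of_projector hus hQ h hκ0' hBA.psi hBA.phi hy ?_ ?_ ?_
    · rw [h00, ← hval]
      simpa only [neg_neg] using (ha z).hasHalfSeries hκ0' (hball κ hκ)
    · rw [h10, ← hval]
      simpa only [neg_neg] using (hb z).hasHalfSeries hκ0' (hball κ hκ)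
    · rw [h01, ← hval]
      simpa only [neg_neg] using (hc z).hasHalfSeries hκ0' (hball κ hκ)
  refine ⟨hcurve, hexp, fun γ hγ l hl0 hl μ ψ φ hμ1 hμ2 hm => ?_⟩
  have hl0' : l ≠ 0 := norm_pos_iff.1 hl0
  rw [Real.sq_sqrt hR.le] at hl
  have hlball : -l ∈ Metric.ball (0 : ℂ) R := by simpa using hl
  -- Periodicity passes from the coefficients to `ξ` wherever the series converge, as the scalar
  -- factor is nonzero and independent of `z`.
  have hξγ : ∀ z, ξ l (z + γ) = ξ l z := fun z => by
    have hper := fun n => h.periodic hus hγ n z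
    have hx0 : -l ≠ 0 := neg_ne_zero.2 hl0'
    have hxR : ‖-l‖ < R := by rwa [norm_neg]
    have hf : - -l / (2 * s (-l)) ≠ 0 :=
      div_ne_zero (neg_ne_zero.2 hx0) (mul_ne_zero two_ne_zero (hs0 _ hlball))
    have e1 := (ha (z + γ) _ hx0 hxR).unique (by simpa only [(hper _).1] using ha z _ hx0 hxR)
    have e2 := (hb (z + γ) _ hx0 hxR).unique (by simpa only [(hper _).2.1] using hb z _ hx0 hxR)
    have e3 := (hc (z + γ) _ hx0 hxR).unique (by simpa only [(hper _).2.2] using hc z _ hx0 hxR)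
    have e1 := mul_left_cancel₀ hf e1
    have e2 := mul_left_cancel₀ hf e2
    have e3 := mul_left_cancel₀ hf e3
    rw [neg_neg] at e1 e2 e3
    ext i j
    fin_cases i <;> fin_cases j
    · exact e1
    · exact e2
    · exact e3
    · simp [hξ.apply_one_one hl0', e1]
  obtain ⟨κ₀, hκ₀⟩ := IsAlgClosed.exists_pow_nat_eq l (n := 2) two_pos
  have hκpos : ∀ κ : ℂ, κ ^ 2 = l → 0 < ‖κ‖ := fun κ hκ =>
    norm_pos_iff.2 fun h0 => hl0' (by rw [← hκ, h0]; ring)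
  have hκlt : ∀ κ : ℂ, κ ^ 2 = l → ‖κ‖ < √R := fun κ hκ => by
    rw [← hκ, norm_pow] at hl
    exact Real.lt_sqrt_of_sq_lt hl
  obtain ⟨-, hν0, hodd, hν⟩ := hcurve κ₀ (hκpos κ₀ hκ₀) (hκlt κ₀ hκ₀)
  have hν : (s (-κ₀ ^ 2) / κ₀) ^ 2 = -(ξ l 0).det := (hν 0).trans (by rw [hκ₀])
  have hdet : (ξ l 0).det ≠ 0 := fun h0 => by
    rw [h0, neg_zero] at hν
    exact hν0 (pow_eq_zero_iff two_ne_zero |>.1 hν)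
  obtain ⟨n, hn, hBA⟩ := exists_isBakerAkhiezerPair hus hξ hl0' hξγ hdet hμ1 hμ2 hm
  -- The eigenvalue agrees with `ν(κ₀)` up to sign; by oddness, replacing `κ₀` by `-κ₀` corrects the
  -- sign.
  obtain ⟨κ, hκ, hnκ⟩ : ∃ κ : ℂ, κ ^ 2 = l ∧ n = s (-κ ^ 2) / κ := by
    rcases sq_eq_sq_iff_eq_or_eq_neg.1 (hn.trans hν.symm) with h1 | h1
    · exact ⟨κ₀, hκ₀, h1⟩
    · exact ⟨-κ₀, by rw [neg_sq, hκ₀], by rw [hodd, h1]⟩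
  rw [hnκ] at hBA
  refine ⟨κ, hκ, hBA, hexp κ (hκpos κ hκ) (hκlt κ hκ) ψ φ ?_⟩
  rw [hκ] at hBA ⊢
  exact hBA
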